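/- Conventions. All groupoids $G$ are locally compact Hausdorff topological groupoids, with unit space $G^{0}$, range and source maps $r,s$, and a (left) Haar system. A continuous family of measures along a continuous map $p\colon X\to U$ is a family $\{\lambda_u\}_{u\in U}$ of Radon measures on $X$, $\lambda_u$ concentrated on $p^{-1}(u)$, such that $u\mapsto\int f\,d\lambda_u$ is continuous for all $f\in C_c(X)$. A topological correspondence $(X,\lambda)$ from $(G,\alpha)$ to $(H,\beta)$ is a locally compact Hausdorff space $X$ with commuting continuous actions of $G$ (left, momentum map $r_X$) and $H$ (right, momentum map $s_X$), the action of $H$ being proper, with an $H$-invariant continuous family of measures $\lambda=\{\lambda_u\}_{u\in H^0}$ along $s_X$, and with a continuous function $\Delta\colon G\ltimes X\to(0,\infty)$ (the adjoining function) such that for all $u\in H^0$ and $F\in C_c(G\times_{G^0}X)$ $$\iint F(\gamma^{-1},x)\,d\alpha^{r_X(x)}(\gamma)\,d\lambda_u(x)=\iint F(\gamma,\gamma^{-1}x)\,\Delta(\gamma,\gamma^{-1}x)\,d\alpha^{r_X(x)}(\gamma)\,d\lambda_u(x).$$ Two families of measures $\lambda,\lambda'$ along the same map are equivalent if $\lambda_u,\lambda'_u$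 are mutually absolutely continuous for each $u$ and the Radon--Nikodym derivatives $d\lambda_u/d\lambda'_u$ are given by one positive continuous function on $X$. An isomorphism $(X,\lambda)\to(X',\lambda')$ of topological correspondences from $(G,\alpha)$ to $(H,\beta)$ is a $G$-$H$-equivariant homeomorphism $\phi\colon X\to X'$ such that $\phi_*\lambda$ and $\lambda'$ are equivalent. Let $(X,\alpha)\colon(G_1,\chi_1)\to(G_2,\chi_2)$ and $(Y,\beta)\colon(G_2,\chi_2)\to(G_3,\chi_3)$ be topological correspondences, with adjoining functions $\Delta_1$ and $\Delta_2$. Let $Z=X\times_{G_2^0}Y$ with the diagonal action $(x,y)\gamma=(x\gamma,\gamma^{-1}y)$ of $G_2$, let $\Omega=Z/G_2$ with the induced actions $\eta[x,y]=[\eta x,y]$ of $G_1$ and $[x,y]\eta=[x,y\eta]$ of $G_3$, let $\pi\colon Z\to\Omega$ be the quotient map, and assume that $\Omega$ is paracompact. A composite of $(X,\alpha)$ and $(Y,\beta)$ obtained by using a $0$-cochain $b$ is a pair $(\Omega,\mu)$ where $b\colon Z\to(0,\infty)$ is continuous and $G_3$-invariant and satisfies $b(x\gamma,\gamma^{-1}y)/b(x,y)=\Delta_2(\gamma^{-1},y)$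 for all $((x,y),\gamma)\in Z\rtimes G_2$, and where $\mu=\{\mu_u\}_{u\in G_3^0}$ is a family of Radon measures on $\Omega$ that lifts to $\{b\,(\alpha\times\beta_u)\}_u$, that is, for all $u\in G_3^0$ and $F\in C_c(Z)$ $$\int_\Omega\int_{G_2}F(x\gamma,\gamma^{-1}y)\,d\chi_2^{r_Y(y)}(\gamma)\,d\mu_u([x,y])=\int_Y\int_X F(x,y)\,b(x,y)\,d\alpha_{r_Y(y)}(x)\,d\beta_u(y).$$ Proposition. Let $(\Omega,\mu)$ and $(\Omega,\mu')$ be composites of $(X,\alpha)$ and $(Y,\beta)$ obtained by using $0$-cochains $b$ and $b'$, respectively. Then $(\Omega,\mu)$ and $(\Omega,\mu')$ are topological correspondences from $(G_1,\chi_1)$ to $(G_3,\chi_3)$, and the identity map of $\Omega$ is an isomorphism between them. Moreover, there is a unique function $c\colon\Omega\to\mathbb R$ with $b'=(c\circ\pi)\,b$; it is continuous and positive, and $\dfrac{d\mu'_u}{d\mu_u}=c$, i.e. $\mu'_u=c\,\mu_u$, for every $u\in G_3^0$. -/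

import Mathlib

open MeasureTheory Topology
open scoped CompactlySupported

noncomputable section

/-- A topological groupoid with space of arrows `G` and space of units `U`.  The product `mul a b` is
defined exactly when `s a = r b`.  (The unit map `one` is automatically an embedding of `U` into
`G`, as it has the continuous left inverse `r`.) -/
structure TopGroupoid (G U : Type*) [TopologicalSpace G] [TopologicalSpace U] where
  r : G → U
  s : G → U
  one : U → G
  inv : G → G
  mul : ∀ a b : G, s a = r b → G
  r_one : ∀ u, r (one u) = u
  s_one : ∀ u, s (one u) = u
  r_inv : ∀ a, r (inv a) = s a
  s_inv : ∀ a, s (inv a) = r a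
  r_mul : ∀ a b h, r (mul a b h) = r a
  s_mul : ∀ a b h, s (mul a b h) = s b
  one_mul : ∀ a, mul (one (r a)) a (s_one (r a)) = a
  mul_one : ∀ a, mul a (one (s a)) (r_one (s a)).symm = a
  inv_mul : ∀ a, mul (inv a) a (s_inv a) = one (s a)
  mul_inv : ∀ a, mul a (inv a) (r_inv a).symm = one (r a)
  mul_assoc : ∀ a b c (hab : s a = r b) (hbc : s b = r c),
    mul (mul a b hab) c ((s_mul a b hab).trans hbc) =
      mul a (mul b c hbc) (hab.trans (r_mul b c hbc).symm)
  continuous_r : Continuous r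
  continuous_s : Continuous s
  continuous_one : Continuous one
  continuous_inv : Continuous inv
  continuous_mul : Continuous fun p : {p : G × G // s p.1 = r p.2} => mul p.1.1 p.1.2 p.2

namespace TopGroupoid

variable {G U : Type*} [TopologicalSpace G] [TopologicalSpace U] (𝓖 : TopGroupoid G U)

theorem mul_congr {a a' b b' : G} (ha : a = a') (hb : b = b') (h : 𝓖.s a = 𝓖.r b)
    (h' : 𝓖.s a' = 𝓖.r b') : 𝓖.mul a b h = 𝓖.mul a' b' h' := by
  subst ha hb; rfl

theorem one_mul' {u : U} {a : G} (h : 𝓖.s (𝓖.one u) = 𝓖.r a) : 𝓖.mul (𝓖.one u) a h = a := by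
  have hu : u = 𝓖.r a := (𝓖.s_one u).symm.trans h
  subst hu; exact 𝓖.one_mul a

theorem mul_one' {u : U} {a : G} (h : 𝓖.s a = 𝓖.r (𝓖.one u)) : 𝓖.mul a (𝓖.one u) h = a := by
  have hu : 𝓖.s a = u := h.trans (𝓖.r_one u)
  subst hu; exact 𝓖.mul_one a

theorem eq_inv {a b : G} (h : 𝓖.s b = 𝓖.r a) (hb : 𝓖.mul b a h = 𝓖.one (𝓖.s a)) :
    b = 𝓖.inv a := by
  have h1 := 𝓖.mul_assoc b a (𝓖.inv a) h (𝓖.r_inv a).symm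
  rw [𝓖.mul_congr hb rfl _ ((𝓖.s_one _).trans (𝓖.r_inv a).symm), 𝓖.one_mul',
    𝓖.mul_congr rfl (𝓖.mul_inv a) _ (h.trans (𝓖.r_one _).symm), 𝓖.mul_one'] at h1
  exact h1.symm

theorem inv_one (u : U) : 𝓖.inv (𝓖.one u) = 𝓖.one u := by
  refine (𝓖.eq_inv ((𝓖.s_one u).trans (𝓖.r_one u).symm) ?_).symm
  rw [𝓖.one_mul', 𝓖.s_one]

theorem inv_mul_rev (a b : G) (h : 𝓖.s a = 𝓖.r b) :
    𝓖.inv (𝓖.mul a b h) = 𝓖.mul (𝓖.inv b) (𝓖.inv a)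
      ((𝓖.s_inv b).trans (h.symm.trans (𝓖.r_inv a).symm)) := by
  have hab : 𝓖.s (𝓖.inv b) = 𝓖.r (𝓖.inv a) := (𝓖.s_inv b).trans (h.symm.trans (𝓖.r_inv a).symm)
  have key : 𝓖.mul (𝓖.inv a) (𝓖.mul a b h) ((𝓖.s_inv a).trans (𝓖.r_mul a b h).symm) = b := by
    rw [← 𝓖.mul_assoc (𝓖.inv a) a b (𝓖.s_inv a) h,
      𝓖.mul_congr (𝓖.inv_mul a) rfl _ ((𝓖.s_one _).trans h), 𝓖.one_mul']
  refine (𝓖.eq_inv ((𝓖.s_mul _ _ _).trans ((𝓖.s_inv a).trans (𝓖.r_mul a b h).symm)) ?_).symm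
  rw [𝓖.mul_assoc (𝓖.inv b) (𝓖.inv a) (𝓖.mul a b h) hab
    ((𝓖.s_inv a).trans (𝓖.r_mul a b h).symm), 𝓖.mul_congr rfl key _ (𝓖.s_inv b), 𝓖.inv_mul,
    𝓖.s_mul]

end TopGroupoid

/-- A continuous family of Radon measures along a map `p : X → U`: each `lam u` is a Radon
measure concentrated on the fibre over `u`, and `u ↦ ∫ f d(lam u)` is continuous for every
continuous compactly supported `f`. -/
structure IsContinuousFamily {X U : Type*} [TopologicalSpace X] [MeasurableSpace X]
    [TopologicalSpace U] (p : X → U) (lam : U → Measure X) : Prop where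
  regular : ∀ u, (lam u).Regular
  concentrated : ∀ u, lam u (p ⁻¹' {u})ᶜ = 0
  continuous_integral : ∀ f : C_c(X, ℝ), Continuous fun u => ∫ x, f x ∂(lam u)

/-- A topological groupoid with a (left) Haar system. -/
structure HaarGroupoid (G U : Type*) [TopologicalSpace G] [TopologicalSpace U]
    [MeasurableSpace G] extends TopGroupoid G U where
  haar : U → Measure G
  haar_family : IsContinuousFamily r haar
  /-- the support of `haar u` is the whole fibre of `r` over `u` -/
  haar_full : ∀ (u : U) (V : Set G), IsOpen V → (V ∩ r ⁻¹' {u}).Nonempty → 0 < haar u V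
  /-- left invariance; the integrand matters only on the fibre of `r` over `s g` -/
  haar_invariant : ∀ (g : G) (f : C_c(G, ℝ)),
    ∫ x, (open Classical in if h : s g = r x then f (mul g x h) else 0) ∂(haar (s g)) =
      ∫ x, f x ∂(haar (r g))

section Actions

variable {G U H V X : Type*} [TopologicalSpace G] [TopologicalSpace U] [TopologicalSpace H]
  [TopologicalSpace V]

/-- A left action of a groupoid on a set `X` with momentum map `mom` (continuity is a separate
predicate). -/
structure LeftAction (𝓖 : TopGroupoid G U) (X : Type*) where
  mom : X → U
  act : ∀ (g : G) (x : X), 𝓖.s g = mom x → X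
  mom_act : ∀ g x h, mom (act g x h) = 𝓖.r g
  one_act : ∀ x, act (𝓖.one (mom x)) x (𝓖.s_one _) = x
  mul_act : ∀ a b x (hab : 𝓖.s a = 𝓖.r b) (h : 𝓖.s b = mom x),
    act (𝓖.mul a b hab) x ((𝓖.s_mul a b hab).trans h) =
      act a (act b x h) (hab.trans (mom_act b x h).symm)

/-- A right action of a groupoid on a set `X` with momentum map `mom`. -/
structure RightAction (𝓗 : TopGroupoid H V) (X : Type*) where
  mom : X → V
  act : ∀ (x : X) (g : H), mom x = 𝓗.r g → X
  mom_act : ∀ x g h, mom (act x g h) = 𝓗.s g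
  act_one : ∀ x, act x (𝓗.one (mom x)) (𝓗.r_one _).symm = x
  act_mul : ∀ x a b (h : mom x = 𝓗.r a) (hab : 𝓗.s a = 𝓗.r b),
    act x (𝓗.mul a b hab) (h.trans (𝓗.r_mul a b hab).symm) =
      act (act x a h) b ((mom_act x a h).trans hab)

theorem LeftAction.act_congr {𝓖 : TopGroupoid G U} (L : LeftAction 𝓖 X) {g g' : G} {x x' : X}
    (hg : g = g') (hx : x = x') (h : 𝓖.s g = L.mom x) (h' : 𝓖.s g' = L.mom x') :
    L.act g x h = L.act g' x' h' := by
  subst hg hx; rfl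

theorem LeftAction.act_of_eq_one {𝓖 : TopGroupoid G U} (L : LeftAction 𝓖 X) {g : G} {x : X} {u : U}
    (hg : g = 𝓖.one u) (h : 𝓖.s g = L.mom x) : L.act g x h = x := by
  subst hg
  have hu : u = L.mom x := (𝓖.s_one u).symm.trans h
  subst hu; exact L.one_act x

theorem RightAction.act_congr {𝓗 : TopGroupoid H V} (R : RightAction 𝓗 X) {g g' : H} {x x' : X}
    (hx : x = x') (hg : g = g') (h : R.mom x = 𝓗.r g) (h' : R.mom x' = 𝓗.r g') :
    R.act x g h = R.act x' g' h' := by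
  subst hg hx; rfl

theorem RightAction.act_of_eq_one {𝓗 : TopGroupoid H V} (R : RightAction 𝓗 X) {g : H} {x : X}
    {u : V} (hg : g = 𝓗.one u) (h : R.mom x = 𝓗.r g) : R.act x g h = x := by
  subst hg
  have hu : R.mom x = u := h.trans (𝓗.r_one u)
  subst hu; exact R.act_one x

/-- The arrow space of the transformation groupoid `𝓖 ⋉ X` of a left action. -/
abbrev LeftAction.Trans {𝓖 : TopGroupoid G U} (L : LeftAction 𝓖 X) : Type _ :=
  {p : G × X // 𝓖.s p.1 = L.mom p.2}

/-- The arrow space of the transformation groupoid `X ⋊ 𝓗` of a right action. -/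
abbrev RightAction.Trans {𝓗 : TopGroupoid H V} (R : RightAction 𝓗 X) : Type _ :=
  {p : X × H // R.mom p.1 = 𝓗.r p.2}

structure LeftAction.IsContinuous [TopologicalSpace X] {𝓖 : TopGroupoid G U}
    (L : LeftAction 𝓖 X) : Prop where
  mom : Continuous L.mom
  act : Continuous fun p : L.Trans => L.act p.1.1 p.1.2 p.2

structure RightAction.IsContinuous [TopologicalSpace X] {𝓗 : TopGroupoid H V}
    (R : RightAction 𝓗 X) : Prop where
  mom : Continuous R.mom
  act : Continuous fun p : R.Trans => R.act p.1.1 p.1.2 p.2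

/-- A right action is proper if `(x, η) ↦ (x, x η)` is a proper map `X ⋊ 𝓗 → X × X`. -/
def RightAction.IsProper [TopologicalSpace X] {𝓗 : TopGroupoid H V}
    (R : RightAction 𝓗 X) : Prop :=
  IsProperMap fun p : R.Trans => ((p.1.1, R.act p.1.1 p.1.2 p.2) : X × X)

/-- A family of measures along the momentum map of a right action is invariant if
`∫ f(xη) dlam_{r(η)}(x) = ∫ f(x) dlam_{s(η)}(x)`. -/
def RightAction.IsInvariantFamily [TopologicalSpace X] [MeasurableSpace X]
    {𝓗 : TopGroupoid H V} (R : RightAction 𝓗 X) (lam : V → Measure X) : Prop :=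
  ∀ (g : H) (f : C_c(X, ℝ)),
    ∫ x, (open Classical in if h : R.mom x = 𝓗.r g then f (R.act x g h) else 0) ∂(lam (𝓗.r g)) =
      ∫ x, f x ∂(lam (𝓗.s g))

/-- Commuting left and right actions. -/
structure Bispace (𝓖 : TopGroupoid G U) (𝓗 : TopGroupoid H V) (X : Type*) where
  left : LeftAction 𝓖 X
  right : RightAction 𝓗 X
  left_mom_act : ∀ x g h, left.mom (right.act x g h) = left.mom x
  right_mom_act : ∀ g x h, right.mom (left.act g x h) = right.mom x
  act_comm : ∀ a x g (h : 𝓖.s a = left.mom x) (h' : right.mom x = 𝓗.r g),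
    right.act (left.act a x h) g ((right_mom_act a x h).trans h') =
      left.act a (right.act x g h') (h.trans (left_mom_act x g h').symm)

/-- The point `(γ⁻¹, x)` of `𝓖 ⋉ X`, for `γ` in the `r`-fibre over the momentum of `x`. -/
def LeftAction.invPt {𝓖 : TopGroupoid G U} (L : LeftAction 𝓖 X) (g : G) (x : X)
    (h : 𝓖.r g = L.mom x) : L.Trans :=
  ⟨(𝓖.inv g, x), (𝓖.s_inv g).trans h⟩

/-- The point `(γ, γ⁻¹x)` of `𝓖 ⋉ X`, for `γ` in the `r`-fibre over the momentum of `x`. -/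
def LeftAction.movePt {𝓖 : TopGroupoid G U} (L : LeftAction 𝓖 X) (g : G) (x : X)
    (h : 𝓖.r g = L.mom x) : L.Trans :=
  ⟨(g, L.act (𝓖.inv g) x ((𝓖.s_inv g).trans h)),
    ((L.mom_act _ _ _).trans (𝓖.r_inv g)).symm⟩

/-- `Δ` is an adjoining function for the family `lam`: a positive continuous function on `𝓖 ⋉ X`
with
`∫∫ F(γ⁻¹,x) dα^{r(x)}(γ) dlam_u(x) = ∫∫ F(γ,γ⁻¹x) Δ(γ,γ⁻¹x) dα^{r(x)}(γ) dlam_u(x)`. -/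
structure IsAdjoining [TopologicalSpace X] [MeasurableSpace G] [MeasurableSpace X]
    (𝓖 : HaarGroupoid G U) (L : LeftAction 𝓖.toTopGroupoid X) (lam : V → Measure X)
    (Δ : L.Trans → ℝ) : Prop where
  continuous : Continuous Δ
  pos : ∀ p, 0 < Δ p
  integral_eq : ∀ (u : V) (F : C_c(L.Trans, ℝ)),
    ∫ x, ∫ g, (open Classical in if h : 𝓖.r g = L.mom x then F (L.invPt g x h) else 0)
        ∂(𝓖.haar (L.mom x)) ∂(lam u) =
      ∫ x, ∫ g, (open Classical in if h : 𝓖.r g = L.mom x then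
          F (L.movePt g x h) * Δ (L.movePt g x h) else 0)
        ∂(𝓖.haar (L.mom x)) ∂(lam u)

/-- A topological correspondence from `𝓖` to `𝓗` with underlying (locally compact Hausdorff) space
`X`, family of measures `lam` and adjoining function `adj`. -/
structure TopologicalCorrespondence [MeasurableSpace G] [MeasurableSpace H]
    (𝓖 : HaarGroupoid G U) (𝓗 : HaarGroupoid H V) (X : Type*) [TopologicalSpace X]
    [MeasurableSpace X] extends Bispace 𝓖.toTopGroupoid 𝓗.toTopGroupoid X where
  t2 : T2Space X
  locallyCompact : LocallyCompactSpace X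
  left_continuous : left.IsContinuous
  right_continuous : right.IsContinuous
  right_proper : right.IsProper
  lam : V → Measure X
  family : IsContinuousFamily right.mom lam
  invariant : right.IsInvariantFamily lam
  adj : left.Trans → ℝ
  adjoining : IsAdjoining 𝓖 left lam adj

end Actions

/-- The function `g` is a Radon–Nikodym derivative `d lam / d lam'` of families of measures. -/
def IsRNDeriv {X V : Type*} [MeasurableSpace X] (lam lam' : V → Measure X) (g : X → ℝ) : Prop :=
  ∀ v, lam v = (lam' v).withDensity fun x => ENNReal.ofReal (g x)

/-- Equivalence of families of measures: the members are fibrewise mutually absolutely continuous,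
and the Radon–Nikodym derivative is a positive continuous function on the total space. -/
def EquivalentFamilies {X V : Type*} [TopologicalSpace X] [MeasurableSpace X]
    (lam lam' : V → Measure X) : Prop :=
  (∀ v, lam v ≪ lam' v ∧ lam' v ≪ lam v) ∧
    ∃ g : X → ℝ, Continuous g ∧ (∀ x, 0 < g x) ∧ IsRNDeriv lam lam' g

/-- The homeomorphism `φ` is an isomorphism of topological correspondences: it is equivariant for
both actions and the push-forward of the first family is equivalent to the second family. -/
structure IsCorrIso {G U H V X X' : Type*} [TopologicalSpace G] [TopologicalSpace U]
    [TopologicalSpace H] [TopologicalSpace V] [TopologicalSpace X] [TopologicalSpace X']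
    [MeasurableSpace G] [MeasurableSpace H] [MeasurableSpace X] [MeasurableSpace X']
    {𝓖 : HaarGroupoid G U} {𝓗 : HaarGroupoid H V}
    (M : TopologicalCorrespondence 𝓖 𝓗 X) (M' : TopologicalCorrespondence 𝓖 𝓗 X')
    (φ : X ≃ₜ X') : Prop where
  left_mom : ∀ x, M'.left.mom (φ x) = M.left.mom x
  right_mom : ∀ x, M'.right.mom (φ x) = M.right.mom x
  left_act : ∀ g x (h : 𝓖.s g = M.left.mom x),
    φ (M.left.act g x h) = M'.left.act g (φ x) (h.trans (left_mom x).symm)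
  right_act : ∀ x g (h : M.right.mom x = 𝓗.r g),
    φ (M.right.act x g h) = M'.right.act (φ x) g ((right_mom x).trans h)
  equivalent : EquivalentFamilies (fun v => (M.lam v).map φ) M'.lam

section Composite

variable {G₁ U₁ G₂ U₂ G₃ U₃ X Y : Type*}
  [TopologicalSpace G₁] [TopologicalSpace U₁] [TopologicalSpace G₂] [TopologicalSpace U₂]
  [TopologicalSpace G₃] [TopologicalSpace U₃]
  {𝓖₁ : TopGroupoid G₁ U₁} {𝓖₂ : TopGroupoid G₂ U₂} {𝓖₃ : TopGroupoid G₃ U₃}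

/-- The fibre product `Z = X ×_{U₂} Y`. -/
def FibreProd (A : Bispace 𝓖₁ 𝓖₂ X) (B : Bispace 𝓖₂ 𝓖₃ Y) : Type _ :=
  {p : X × Y // A.right.mom p.1 = B.left.mom p.2}

instance [TopologicalSpace X] [TopologicalSpace Y] (A : Bispace 𝓖₁ 𝓖₂ X)
    (B : Bispace 𝓖₂ 𝓖₃ Y) : TopologicalSpace (FibreProd A B) :=
  inferInstanceAs (TopologicalSpace {p : X × Y // A.right.mom p.1 = B.left.mom p.2})

namespace FibreProd

variable {A : Bispace 𝓖₁ 𝓖₂ X} {B : Bispace 𝓖₂ 𝓖₃ Y}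

def fst (z : FibreProd A B) : X := z.1.1

def snd (z : FibreProd A B) : Y := z.1.2

theorem ext' {z w : FibreProd A B} (h₁ : z.fst = w.fst) (h₂ : z.snd = w.snd) : z = w :=
  Subtype.ext (Prod.ext h₁ h₂)

/-- `s_Z(x,y) = s_X(x)`. -/
def mom (z : FibreProd A B) : U₂ := A.right.mom z.fst

theorem mom_eq (z : FibreProd A B) : B.left.mom z.snd = z.mom := z.2.symm

theorem s_inv_eq (z : FibreProd A B) (g : G₂) (h : z.mom = 𝓖₂.r g) :
    𝓖₂.s (𝓖₂.inv g) = B.left.mom z.snd :=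
  (𝓖₂.s_inv g).trans (h.symm.trans z.2)

/-- The diagonal action `(x,y)γ = (xγ, γ⁻¹y)`. -/
def diag (z : FibreProd A B) (g : G₂) (h : z.mom = 𝓖₂.r g) : FibreProd A B :=
  ⟨(A.right.act z.fst g h, B.left.act (𝓖₂.inv g) z.snd (z.s_inv_eq g h)),
    (A.right.mom_act _ _ _).trans (((B.left.mom_act _ _ _).trans (𝓖₂.r_inv g)).symm)⟩

/-- `η(x,y) = (ηx,y)`. -/
def leftAct (g : G₁) (z : FibreProd A B) (h : 𝓖₁.s g = A.left.mom z.fst) : FibreProd A B :=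
  ⟨(A.left.act g z.fst h, z.snd), (A.right_mom_act _ _ _).trans z.2⟩

/-- `(x,y)η = (x,yη)`. -/
def rightAct (z : FibreProd A B) (g : G₃) (h : B.right.mom z.snd = 𝓖₃.r g) : FibreProd A B :=
  ⟨(z.fst, B.right.act z.snd g h), z.2.trans (B.left_mom_act _ _ _).symm⟩

/-- Two points are related if they lie in the same orbit of the diagonal action. -/
def Rel (z w : FibreProd A B) : Prop := ∃ (g : G₂) (h : z.mom = 𝓖₂.r g), w = z.diag g h

theorem rel_equivalence : Equivalence (Rel (A := A) (B := B)) where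
  refl z := by
    refine ⟨𝓖₂.one z.mom, (𝓖₂.r_one _).symm, ext' ?_ ?_⟩
    · exact (A.right.act_of_eq_one rfl _).symm
    · exact (B.left.act_of_eq_one (𝓖₂.inv_one _) _).symm
  symm := by
    rintro z _ ⟨g, h, rfl⟩
    have hm : (z.diag g h).mom = 𝓖₂.r (𝓖₂.inv g) := (A.right.mom_act _ _ _).trans (𝓖₂.r_inv g).symm
    refine ⟨𝓖₂.inv g, hm, ext' ?_ ?_⟩
    · have := A.right.act_mul z.fst g (𝓖₂.inv g) h (𝓖₂.r_inv g).symm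
      rw [A.right.act_of_eq_one (𝓖₂.mul_inv g)] at this
      exact this
    · have := B.left.mul_act (𝓖₂.inv (𝓖₂.inv g)) (𝓖₂.inv g) z.snd (𝓖₂.s_inv _) (z.s_inv_eq g h)
      rw [B.left.act_of_eq_one (𝓖₂.inv_mul (𝓖₂.inv g))] at this
      exact this
  trans := by
    rintro z _ _ ⟨g, h, rfl⟩ ⟨g', h', rfl⟩
    have hg : 𝓖₂.s g = 𝓖₂.r g' := (A.right.mom_act z.fst g h).symm.trans h'
    refine ⟨𝓖₂.mul g g' hg, h.trans (𝓖₂.r_mul _ _ _).symm, ext' ?_ ?_⟩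
    · exact (A.right.act_mul z.fst g g' h hg).symm
    · have hab : 𝓖₂.s (𝓖₂.inv g') = 𝓖₂.r (𝓖₂.inv g) :=
        (𝓖₂.s_inv g').trans (hg.symm.trans (𝓖₂.r_inv g).symm)
      refine (B.left.mul_act (𝓖₂.inv g') (𝓖₂.inv g) z.snd hab (z.s_inv_eq g h)).symm.trans ?_
      exact B.left.act_congr (𝓖₂.inv_mul_rev g g' hg).symm rfl _ _

theorem diag_leftAct (a : G₁) (z : FibreProd A B) (g : G₂) (ha : 𝓖₁.s a = A.left.mom z.fst)
    (h : z.mom = 𝓖₂.r g) :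
    (leftAct a z ha).diag g ((A.right_mom_act _ _ _).trans h) =
      leftAct a (z.diag g h) (ha.trans (A.left_mom_act _ _ _).symm) :=
  ext' (A.act_comm a z.fst g ha h) rfl

theorem diag_rightAct (z : FibreProd A B) (g : G₂) (c : G₃) (h : z.mom = 𝓖₂.r g)
    (hc : B.right.mom z.snd = 𝓖₃.r c) :
    (rightAct z c hc).diag g h =
      rightAct (z.diag g h) c ((B.right_mom_act _ _ _).trans hc) :=
  ext' rfl (B.act_comm (𝓖₂.inv g) z.snd c (z.s_inv_eq g h) hc).symm

end FibreProd

/-- The orbit space `Ω = (X ×_{U₂} Y) / G₂` of the diagonal action. -/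
def OrbitSpace (A : Bispace 𝓖₁ 𝓖₂ X) (B : Bispace 𝓖₂ 𝓖₃ Y) : Type _ :=
  Quotient (⟨FibreProd.Rel, FibreProd.rel_equivalence⟩ : Setoid (FibreProd A B))

namespace OrbitSpace

/-- The quotient topology. -/
instance [TopologicalSpace X] [TopologicalSpace Y] (A : Bispace 𝓖₁ 𝓖₂ X)
    (B : Bispace 𝓖₂ 𝓖₃ Y) : TopologicalSpace (OrbitSpace A B) :=
  inferInstanceAs (TopologicalSpace
    (Quotient (⟨FibreProd.Rel, FibreProd.rel_equivalence⟩ : Setoid (FibreProd A B))))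

/-- The Borel σ-algebra of the quotient topology. -/
instance [TopologicalSpace X] [TopologicalSpace Y] (A : Bispace 𝓖₁ 𝓖₂ X)
    (B : Bispace 𝓖₂ 𝓖₃ Y) : MeasurableSpace (OrbitSpace A B) := borel _

instance [TopologicalSpace X] [TopologicalSpace Y] (A : Bispace 𝓖₁ 𝓖₂ X)
    (B : Bispace 𝓖₂ 𝓖₃ Y) : BorelSpace (OrbitSpace A B) := ⟨rfl⟩

variable {A : Bispace 𝓖₁ 𝓖₂ X} {B : Bispace 𝓖₂ 𝓖₃ Y}

/-- The quotient map `π : Z → Ω`. -/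
def proj (z : FibreProd A B) : OrbitSpace A B := Quotient.mk _ z

/-- A chosen representative of an orbit. -/
def rep (ω : OrbitSpace A B) : FibreProd A B := Quotient.out ω

theorem proj_surjective (ω : OrbitSpace A B) : ∃ z, proj z = ω := Quotient.exists_rep ω

theorem proj_rep (ω : OrbitSpace A B) : proj (rep ω) = ω := Quotient.out_eq ω

theorem proj_eq_iff {z w : FibreProd A B} : proj z = proj w ↔ FibreProd.Rel z w :=
  ⟨fun h => Quotient.exact h, fun h => Quotient.sound h⟩

/-- The left momentum map `[x,y] ↦ r_X(x)`. -/
def leftMom (ω : OrbitSpace A B) : U₁ :=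
  Quotient.lift (fun z : FibreProd A B => A.left.mom z.fst)
    (by rintro z _ ⟨g, h, rfl⟩; exact (A.left_mom_act _ _ _).symm) ω

/-- The right momentum map `[x,y] ↦ s_Y(y)`. -/
def rightMom (ω : OrbitSpace A B) : U₃ :=
  Quotient.lift (fun z : FibreProd A B => B.right.mom z.snd)
    (by rintro z _ ⟨g, h, rfl⟩; exact (B.right_mom_act _ _ _).symm) ω

open Classical in
/-- `η[x,y] = [ηx,y]`; the value is irrelevant if `η` and `[x,y]` are not composable. -/
def leftActAux (a : G₁) (ω : OrbitSpace A B) : OrbitSpace A B :=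
  Quotient.lift (fun z : FibreProd A B =>
      if h : 𝓖₁.s a = A.left.mom z.fst then proj (FibreProd.leftAct a z h) else proj z)
    (by
      rintro z _ ⟨g, h, rfl⟩
      have hm : A.left.mom (z.diag g h).fst = A.left.mom z.fst := A.left_mom_act _ _ _
      by_cases ha : 𝓖₁.s a = A.left.mom z.fst
      · simp only [dif_pos ha, dif_pos (ha.trans hm.symm)]
        exact proj_eq_iff.2 ⟨g, _, (FibreProd.diag_leftAct a z g ha h).symm⟩
      · simp only [dif_neg ha, dif_neg (hm ▸ ha)]
        exact proj_eq_iff.2 ⟨g, h, rfl⟩) ω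

open Classical in
/-- `[x,y]η = [x,yη]`; the value is irrelevant if `[x,y]` and `η` are not composable. -/
def rightActAux (ω : OrbitSpace A B) (c : G₃) : OrbitSpace A B :=
  Quotient.lift (fun z : FibreProd A B =>
      if h : B.right.mom z.snd = 𝓖₃.r c then proj (FibreProd.rightAct z c h) else proj z)
    (by
      rintro z _ ⟨g, h, rfl⟩
      have hm : B.right.mom (z.diag g h).snd = B.right.mom z.snd := B.right_mom_act _ _ _
      by_cases hc : B.right.mom z.snd = 𝓖₃.r c
      · simp only [dif_pos hc, dif_pos (hm.trans hc)]
        exact proj_eq_iff.2 ⟨g, h, (FibreProd.diag_rightAct z g c h hc).symm⟩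
      · simp only [dif_neg hc, dif_neg (hm.symm ▸ hc)]
        exact proj_eq_iff.2 ⟨g, h, rfl⟩) ω

theorem leftActAux_proj (a : G₁) (z : FibreProd A B) (h : 𝓖₁.s a = A.left.mom z.fst) :
    leftActAux a (proj z) = proj (FibreProd.leftAct a z h) := dif_pos h

theorem rightActAux_proj (z : FibreProd A B) (c : G₃) (h : B.right.mom z.snd = 𝓖₃.r c) :
    rightActAux (proj z) c = proj (FibreProd.rightAct z c h) := dif_pos h

variable (A B) in
/-- The `G₁`-`G₃`-bispace structure on `Ω` induced from `Z`. -/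
def bispace : Bispace 𝓖₁ 𝓖₃ (OrbitSpace A B) where
  left :=
    { mom := leftMom
      act := fun a ω _ => leftActAux a ω
      mom_act := fun a ω => by
        obtain ⟨z, rfl⟩ := proj_surjective ω
        intro h
        rw [leftActAux_proj a z h]
        exact A.left.mom_act _ _ _
      one_act := fun ω => by
        obtain ⟨z, rfl⟩ := proj_surjective ω
        refine (leftActAux_proj _ z (𝓖₁.s_one _)).trans ?_
        exact congrArg proj (FibreProd.ext' (A.left.one_act _) rfl)
      mul_act := fun a b ω => by
        obtain ⟨z, rfl⟩ := proj_surjective ω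
        intro hab h
        rw [leftActAux_proj _ z ((𝓖₁.s_mul a b hab).trans h), leftActAux_proj b z h,
          leftActAux_proj a _ (hab.trans (A.left.mom_act b z.fst h).symm)]
        exact congrArg proj (FibreProd.ext' (A.left.mul_act a b z.fst hab h) rfl) }
  right :=
    { mom := rightMom
      act := fun ω c _ => rightActAux ω c
      mom_act := fun ω c => by
        obtain ⟨z, rfl⟩ := proj_surjective ω
        intro h
        rw [rightActAux_proj z c h]
        exact B.right.mom_act _ _ _
      act_one := fun ω => by
        obtain ⟨z, rfl⟩ := proj_surjective ω
        refine (rightActAux_proj z _ (𝓖₃.r_one _).symm).trans ?_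
        exact congrArg proj (FibreProd.ext' rfl (B.right.act_one _))
      act_mul := fun ω a b => by
        obtain ⟨z, rfl⟩ := proj_surjective ω
        intro h hab
        rw [rightActAux_proj z _ (h.trans (𝓖₃.r_mul a b hab).symm), rightActAux_proj z a h,
          rightActAux_proj _ b ((B.right.mom_act z.snd a h).trans hab)]
        exact congrArg proj (FibreProd.ext' rfl (B.right.act_mul z.snd a b h hab)) }
  left_mom_act := fun ω c => by
    obtain ⟨z, rfl⟩ := proj_surjective ω
    intro h
    change leftMom (rightActAux (proj z) c) = _
    rw [rightActAux_proj z c h]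
    rfl
  right_mom_act := fun a ω => by
    obtain ⟨z, rfl⟩ := proj_surjective ω
    intro h
    change rightMom (leftActAux a (proj z)) = _
    rw [leftActAux_proj a z h]
    rfl
  act_comm := fun a ω c => by
    obtain ⟨z, rfl⟩ := proj_surjective ω
    intro h h'
    change 𝓖₁.s a = A.left.mom z.fst at h
    change B.right.mom z.snd = 𝓖₃.r c at h'
    change rightActAux (leftActAux a (proj z)) c = leftActAux a (rightActAux (proj z) c)
    rw [leftActAux_proj a z h, rightActAux_proj z c h']
    exact (rightActAux_proj (FibreProd.leftAct a z h) c h').trans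
      (leftActAux_proj a (FibreProd.rightAct z c h') h).symm

end OrbitSpace

end Composite

section CompositeMeasures

variable {G₁ U₁ G₂ U₂ G₃ U₃ X Y : Type*}
  [TopologicalSpace G₁] [TopologicalSpace U₁] [TopologicalSpace G₂] [TopologicalSpace U₂]
  [TopologicalSpace G₃] [TopologicalSpace U₃] [TopologicalSpace X] [TopologicalSpace Y]
  [MeasurableSpace G₁] [MeasurableSpace G₂] [MeasurableSpace G₃]
  [MeasurableSpace X] [MeasurableSpace Y]
  {𝓖₁ : HaarGroupoid G₁ U₁} {𝓖₂ : HaarGroupoid G₂ U₂} {𝓖₃ : HaarGroupoid G₃ U₃}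

/-- A 0-cochain `b` on `(X ×_{U₂} Y) ⋊ G₂` as used to form composites: a `G₃`-invariant continuous
function `b : Z → (0,∞)` with `d⁰(b) = D`, where `d⁰(b)(z,γ) = b(zγ)/b(z)` and
`D((x,y),γ) = Δ₂(γ⁻¹,y)` for the adjoining function `Δ₂` of the second correspondence. -/
structure IsCompositeCochain (𝒳 : TopologicalCorrespondence 𝓖₁ 𝓖₂ X)
    (𝒴 : TopologicalCorrespondence 𝓖₂ 𝓖₃ Y)
    (b : FibreProd 𝒳.toBispace 𝒴.toBispace → ℝ) : Prop where
  continuous : Continuous b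
  pos : ∀ z, 0 < b z
  invariant : ∀ z c (h : 𝒴.right.mom z.snd = 𝓖₃.r c), b (z.rightAct c h) = b z
  coboundary : ∀ z g (h : z.mom = 𝓖₂.r g),
    b (z.diag g h) / b z = 𝒴.adj ⟨(𝓖₂.inv g, z.snd), z.s_inv_eq g h⟩

/-- `∫_Z F dλ^ω = ∫ F(xγ, γ⁻¹y) dχ₂(γ)` for `ω = [x,y]`; by left invariance of the Haar system
this does not depend on the representative. -/
def orbitIntegral (𝒳 : TopologicalCorrespondence 𝓖₁ 𝓖₂ X)
    (𝒴 : TopologicalCorrespondence 𝓖₂ 𝓖₃ Y)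
    (F : FibreProd 𝒳.toBispace 𝒴.toBispace → ℝ)
    (ω : OrbitSpace 𝒳.toBispace 𝒴.toBispace) : ℝ :=
  ∫ g, (open Classical in if h : ω.rep.mom = 𝓖₂.r g then F (ω.rep.diag g h) else 0)
    ∂(𝓖₂.haar ω.rep.mom)

/-- `∫_Z F dm_u = ∫_Y ∫_X F(x,y) dα_{r_Y(y)}(x) dβ_u(y)`, that is, the integral of `F` with respect
to `α × β_u`. -/
def fibreProdIntegral (𝒳 : TopologicalCorrespondence 𝓖₁ 𝓖₂ X)
    (𝒴 : TopologicalCorrespondence 𝓖₂ 𝓖₃ Y) (u : U₃)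
    (F : FibreProd 𝒳.toBispace 𝒴.toBispace → ℝ) : ℝ :=
  ∫ y, ∫ x, (open Classical in
      if h : 𝒳.right.mom x = 𝒴.left.mom y then F ⟨(x, y), h⟩ else 0)
    ∂(𝒳.lam (𝒴.left.mom y)) ∂(𝒴.lam u)

/-- `(Ω, μ)`, with `Ω = (X ×_{U₂} Y)/G₂`, is the composite of `𝒳` and `𝒴` obtained by using the
0-cochain `b`: each `μ u` is a Radon measure on `Ω` which lifts to `b (α × β_u)` on `Z`, that is,
`∫_Ω ∫_Z F dλ^ω dμ_u(ω) = ∫_Z F b d(α × β_u)` for all `F ∈ C_c(Z)`. -/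
structure IsComposite (𝒳 : TopologicalCorrespondence 𝓖₁ 𝓖₂ X)
    (𝒴 : TopologicalCorrespondence 𝓖₂ 𝓖₃ Y)
    (b : FibreProd 𝒳.toBispace 𝒴.toBispace → ℝ)
    (μ : U₃ → Measure (OrbitSpace 𝒳.toBispace 𝒴.toBispace)) : Prop where
  cochain : IsCompositeCochain 𝒳 𝒴 b
  regular : ∀ u, (μ u).Regular
  lift : ∀ (u : U₃) (F : C_c(FibreProd 𝒳.toBispace 𝒴.toBispace, ℝ)),
    ∫ ω, orbitIntegral 𝒳 𝒴 F ω ∂(μ u) = fibreProdIntegral 𝒳 𝒴 u fun z => F z * b z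

end CompositeMeasures

end

/-! The mechanism is a cutoff function. The Haar system of `G₂` has full support, so its range map
is open and the orbit map π : Z → Ω is an open quotient map. The diagonal action is proper, so Ω is
locally compact Hausdorff. Paracompactness of Ω then gives φ ≥ 0 on Z, compactly supported over
compact sets, with integral 1 over every orbit (`exists_isCutoff`). Each f in C_c(Ω) is therefore
the orbit integral of φ·(f ∘ π), and the lifting property of μ becomes ∫ f dμ_u = ∫ φ (f ∘ π) b d(α
× β_u) (`IsComposite.integral_eq`). Questions about μ are thereby moved to Z.

The cochains b and b' have the same coboundary, so b'/b is constant on orbits and descends to a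
function c, continuous because π is a quotient map. The formula gives ∫ f dμ'_u = ∫ f c dμ_u for all
f in C_c(Ω), and `eq_withDensity_of_integral_eq` upgrades this to μ'_u = c μ_u.

That (Ω, μ) is a correspondence is read off from the same formula. Invariance comes from that of β
and b. The adjoining function is the average against φ of Δ₁(g, x) b(x, y) / b(gx, y) along orbits;
averaging produces a function on Ω without showing that Δ₁ is `G₂`-invariant. Its defining identity
is the one for Δ₁ on the fibres of Z → Y (`integral_adjoiningIntegrand`), carried back to Ω by the
lifting property and Fubini (`integral_compositeAdj_eq`).

Most integrands make sense only on closed sets of composable pairs. They are replaced by compactly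
supported continuous extensions (`exists_compactlySupported_eqOn`), which also gives Fubini without
σ-finiteness. -/

noncomputable section

/-! ### Compactly supported functions on locally compact Hausdorff spaces -/

section CompactSupport

variable {X : Type*} [TopologicalSpace X] [T2Space X] [LocallyCompactSpace X]

/-- Tietze extension for functions with compact support on a closed subset of a locally compact
Hausdorff space. -/
theorem exists_compactlySupported_eqOn {S K : Set X} (hS : IsClosed S) (hK : IsCompact K)
    {f : X → ℝ} (hf : ContinuousOn f S) (hfK : ∀ x ∈ S, f x ≠ 0 → x ∈ K) :
    ∃ F : C_c(X, ℝ), ∀ x ∈ S, F x = f x := by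
  obtain ⟨K', hK', hKK'⟩ := exists_compact_superset hK
  obtain ⟨χ, hχ1, hχ2, hχ3, -⟩ := exists_continuousMap_one_of_isCompact_subset_isOpen hK
    isOpen_interior hKK'
  have : CompactSpace K' := isCompact_iff_compactSpace.1 hK'
  let S' : Set K' := Subtype.val ⁻¹' S
  have hS' : IsClosed S' := hS.preimage continuous_subtype_val
  have hf' : Continuous fun x : S' => f x.1.1 := by
    refine hf.comp_continuous (by fun_prop) fun x => x.2
  -- Tietze is applied inside the compact, hence normal, neighbourhood `K'`. Multiplying by the bump
  -- function `χ`, equal to 1 on `K` and supported in the interior of `K'`, allows extension by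
  -- zero.
  obtain ⟨g, hg⟩ := ContinuousMap.exists_restrict_eq hS' (⟨_, hf'⟩ : C(S', ℝ))
  have hg' : ∀ x (hx : x ∈ K'), x ∈ S → g ⟨x, hx⟩ = f x := fun x hx hxS =>
    congrArg (fun k : C(S', ℝ) => k ⟨⟨x, hx⟩, hxS⟩) hg
  classical
  let F : X → ℝ := fun x => if hx : x ∈ K' then χ x * g ⟨x, hx⟩ else 0
  have hF0 : ∀ x, x ∉ tsupport χ → F x = 0 := fun x hx => by
    simp only [F]; split_ifs
    · rw [image_eq_zero_of_notMem_tsupport hx, zero_mul]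
    · rfl
  have hFc : Continuous F := by
    rw [continuous_iff_continuousAt]
    intro x
    by_cases hx : x ∈ tsupport χ
    · have hxi : interior K' ∈ 𝓝 x := isOpen_interior.mem_nhds (hχ3 hx)
      have h1 : ContinuousOn F (interior K') := by
        rw [continuousOn_iff_continuous_domRestrict]
        have : (interior K').domRestrict F =
            fun y => χ y.1 * g ⟨y.1, interior_subset y.2⟩ := by
          funext y
          exact dif_pos (interior_subset y.2)
        rw [this]; fun_prop
      exact h1.continuousAt hxi
    · have : F =ᶠ[𝓝 x] fun _ => 0 := by
        filter_upwards [(isClosed_tsupport χ).isOpen_compl.mem_nhds hx] with y hy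
        exact hF0 y hy
      exact continuousAt_const.congr this.symm
  refine ⟨⟨⟨F, hFc⟩, ?_⟩, fun x hx => ?_⟩
  · refine HasCompactSupport.of_support_subset_isCompact (K := tsupport χ) hχ2 fun x hx => ?_
    by_contra h
    exact hx (hF0 x h)
  · change F x = f x
    simp only [F]
    split_ifs with hxK
    · rw [hg' x hxK hx]
      by_cases h0 : f x = 0
      · rw [h0, mul_zero]
      · rw [hχ1 (hfK x hx h0)]; simp
    · by_contra h0
      exact hxK (interior_subset (hKK' (hfK x hx (Ne.symm h0))))

theorem exists_compactlySupported_eq_one {K V : Set X} (hK : IsCompact K) (hV : IsOpen V)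
    (hKV : K ⊆ V) :
    ∃ F : C_c(X, ℝ), (∀ x ∈ K, F x = 1) ∧ (∀ x, 0 ≤ F x) ∧ (∀ x, F x ≤ 1) ∧
      ∀ x, F x ≠ 0 → x ∈ V := by
  obtain ⟨χ, h1, h2, h3, h4⟩ := exists_continuousMap_one_of_isCompact_subset_isOpen hK hV hKV
  exact ⟨⟨χ, h2⟩, fun x hx => h1 hx, fun x => (h4 x).1, fun x => (h4 x).2,
    fun x hx => h3 (subset_tsupport _ hx)⟩

end CompactSupport

/-! ### Radon measures related by a continuous density -/

section Density

variable {X : Type*} [TopologicalSpace X] [T2Space X] [LocallyCompactSpace X] [MeasurableSpace X]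
  [BorelSpace X]

/-- Inner regularity of `ν` reduces to compact `K ⊆ V`. A bump function between the indicators of
`K` and `V` transfers the bound, as `c ≤ B` wherever it is nonzero. -/
theorem measure_isOpen_le_of_integral_le {μ ν : Measure X} [μ.Regular] [ν.Regular]
    {c : X → ℝ} (hc : Continuous c)
    (h : ∀ f : C_c(X, ℝ), ∫ x, f x ∂ν = ∫ x, f x * c x ∂μ) {B : ℝ} {V : Set X}
    (hV : IsOpen V) (hB : ∀ x ∈ V, c x ≤ B) : ν V ≤ ENNReal.ofReal B * μ V := by
  rw [hV.measure_eq_iSup_isCompact]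
  refine iSup₂_le fun K hKV => iSup_le fun hK => ?_
  obtain ⟨f, f1, f0, fle, fV⟩ := exists_compactlySupported_eq_one hK hV hKV
  calc ν K = ∫⁻ x, K.indicator 1 x ∂ν := (lintegral_indicator_one hK.measurableSet).symm
    _ ≤ ∫⁻ x, ENNReal.ofReal (f x) ∂ν := by
      refine lintegral_mono fun x => ?_
      by_cases hx : x ∈ K
      · simp [hx, f1 x hx]
      · simp [hx]
    _ = ENNReal.ofReal (∫ x, f x ∂ν) :=
      (ofReal_integral_eq_lintegral_ofReal f.integrable (.of_forall f0)).symm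
    _ = ENNReal.ofReal (∫ x, f x * c x ∂μ) := by rw [h]
    _ ≤ ENNReal.ofReal (∫ x, B * f x ∂μ) := by
      refine ENNReal.ofReal_le_ofReal (integral_mono ?_ (f.integrable.const_mul _) fun x => ?_)
      · exact (f.continuous.mul hc).integrable_of_hasCompactSupport f.hasCompactSupport.mul_right
      · by_cases hx : f x = 0
        · simp [hx]
        · have := mul_le_mul_of_nonneg_left (hB x (fV x hx)) (f0 x)
          simpa only [mul_comm] using this
    _ = ENNReal.ofReal (B * ∫ x, f x ∂μ) := by rw [integral_const_mul]
    _ = ENNReal.ofReal B * ∫⁻ x, ENNReal.ofReal (f x) ∂μ := by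
      rw [ENNReal.ofReal_mul' (integral_nonneg f0),
        ofReal_integral_eq_lintegral_ofReal f.integrable (.of_forall f0)]
    _ ≤ ENNReal.ofReal B * μ V := by
      gcongr
      rw [← lintegral_indicator_one hV.measurableSet]
      refine lintegral_mono fun x => ?_
      by_cases hx : f x = 0
      · simp [hx]
      · simpa [Set.indicator_of_mem (fV x hx)] using fle x

/-- Outer regularity of `μ` passes from open sets to arbitrary ones. The strict bound `c x < B` is
what puts `A` inside an open set where the previous estimate applies. -/
theorem measure_le_of_integral_le {μ ν : Measure X} [μ.Regular] [ν.Regular]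
    {c : X → ℝ} (hc : Continuous c)
    (h : ∀ f : C_c(X, ℝ), ∫ x, f x ∂ν = ∫ x, f x * c x ∂μ) {B : ℝ} (hB0 : 0 < B) {A : Set X}
    (hB : ∀ x ∈ A, c x < B) : ν A ≤ ENNReal.ofReal B * μ A := by
  have hB1 : ENNReal.ofReal B ≠ 0 := by simpa using hB0
  rw [mul_comm, ← ENNReal.div_le_iff_le_mul (.inl hB1) (.inl ENNReal.ofReal_ne_top),
    A.measure_eq_iInf_isOpen μ]
  refine le_iInf₂ fun V hAV => le_iInf fun hV => ?_
  rw [ENNReal.div_le_iff_le_mul (.inl hB1) (.inl ENNReal.ofReal_ne_top), mul_comm]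
  have hW : IsOpen (V ∩ {x | c x < B}) := hV.inter (isOpen_lt hc continuous_const)
  calc ν A ≤ ν (V ∩ {x | c x < B}) := measure_mono fun x hx => ⟨hAV hx, hB x hx⟩
    _ ≤ ENNReal.ofReal B * μ (V ∩ {x | c x < B}) :=
      measure_isOpen_le_of_integral_le hc h hW fun x hx => hx.2.le
    _ ≤ _ := by gcongr; exact Set.inter_subset_left

/-- Slice along the level sets t ^ n ≤ c < t ^ (n + 1). On each slice ν is at most t ^ (n + 1) μ,
which exceeds the density measure by a factor of at most t; sum over n and let t decrease to 1.
Neither σ-finiteness nor regularity of the density measure is needed. -/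
theorem le_withDensity_of_integral_eq {μ ν : Measure X} [μ.Regular] [ν.Regular]
    {c : X → ℝ} (hc : Continuous c) (hc0 : ∀ x, 0 < c x)
    (h : ∀ f : C_c(X, ℝ), ∫ x, f x ∂ν = ∫ x, f x * c x ∂μ) :
    ν ≤ μ.withDensity fun x => ENNReal.ofReal (c x) := by
  have hm : Measurable fun x => ENNReal.ofReal (c x) := hc.measurable.ennreal_ofReal
  have key : ∀ t : NNReal, 1 < t → ∀ A, MeasurableSet A →
      ν A ≤ t * μ.withDensity (fun x => ENNReal.ofReal (c x)) A := by
    intro t ht A hA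
    have hz : (fun x => ENNReal.ofReal (c x)) ⁻¹' {0} = ∅ := by
      ext x; simpa using hc0 x
    have hi : (fun x => ENNReal.ofReal (c x)) ⁻¹' {⊤} = ∅ := by
      ext x; simp
    rw [measure_eq_measure_preimage_add_measure_tsum_Ico_zpow ν hm hA ht,
      measure_eq_measure_preimage_add_measure_tsum_Ico_zpow (μ.withDensity _) hm hA ht, hz, hi]
    simp only [Set.inter_empty, measure_empty, zero_add, ← ENNReal.tsum_mul_left]
    refine ENNReal.tsum_le_tsum fun n => ?_
    set An := A ∩ (fun x => ENNReal.ofReal (c x)) ⁻¹' Set.Ico ((t : ENNReal) ^ n) (t ^ (n + 1))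
    have hAn : MeasurableSet An := hA.inter (hm measurableSet_Ico)
    have ht0 : t ≠ 0 := (zero_lt_one.trans ht).ne'
    have htp : ENNReal.ofReal ((t : ℝ) ^ (n + 1)) = (t : ENNReal) ^ (n + 1) := by
      rw [← ENNReal.coe_zpow ht0, ← NNReal.coe_zpow, ENNReal.ofReal_coe_nnreal]
    have hpos : (0 : ℝ) < (t : ℝ) ^ (n + 1) := zpow_pos (by positivity) _
    calc ν An ≤ ENNReal.ofReal ((t : ℝ) ^ (n + 1)) * μ An := by
          refine measure_le_of_integral_le hc h hpos fun x hx => ?_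
          have := hx.2.2
          rw [← htp] at this
          exact (ENNReal.ofReal_lt_ofReal_iff hpos).1 this
      _ = t * (t ^ n * μ An) := by
          rw [htp, ENNReal.zpow_add (by simpa using ht0) (by simp), zpow_one]; ring
      _ ≤ t * μ.withDensity (fun x => ENNReal.ofReal (c x)) An := by
          gcongr
          rw [withDensity_apply _ hAn, ← setLIntegral_const]
          exact setLIntegral_mono hm fun x hx => hx.2.1
  refine Measure.le_iff.2 fun A hA => ?_
  -- The limit t → 1 is taken with t = a⁻¹ for a < 1.
  refine ENNReal.le_of_forall_lt_one_mul_le fun a ha => ?_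
  lift a to NNReal using (ha.trans ENNReal.one_lt_top).ne
  rcases eq_or_ne a 0 with rfl | ha0
  · simp
  have h1 := key a⁻¹ ((one_lt_inv₀ (pos_iff_ne_zero.2 ha0)).2 (by exact_mod_cast ha)) A hA
  rw [ENNReal.coe_inv ha0] at h1
  exact ENNReal.mul_le_of_le_div' (by rwa [ENNReal.div_eq_inv_mul])

/-- The hypothesis is symmetric under exchanging `μ` and `ν` and replacing `c` by its inverse, so
the one-sided bound yields both inequalities. -/
theorem eq_withDensity_of_integral_eq {μ ν : Measure X} [μ.Regular] [ν.Regular]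
    {c : X → ℝ} (hc : Continuous c) (hc0 : ∀ x, 0 < c x)
    (h : ∀ f : C_c(X, ℝ), ∫ x, f x ∂ν = ∫ x, f x * c x ∂μ) :
    ν = μ.withDensity fun x => ENNReal.ofReal (c x) := by
  refine le_antisymm (le_withDensity_of_integral_eq hc hc0 h) ?_
  have hc' : Continuous fun x => (c x)⁻¹ := hc.inv₀ fun x => (hc0 x).ne'
  have h' : ∀ f : C_c(X, ℝ), ∫ x, f x ∂μ = ∫ x, f x * (c x)⁻¹ ∂ν := fun f => by
    have := h ⟨⟨fun x => f x * (c x)⁻¹, f.continuous.mul hc'⟩, f.hasCompactSupport.mul_right⟩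
    refine Eq.trans ?_ this.symm
    refine integral_congr_ae (.of_forall fun x => ?_)
    simp [mul_assoc, inv_mul_cancel₀ (hc0 x).ne']
  have h2 := le_withDensity_of_integral_eq hc' (fun x => inv_pos.2 (hc0 x)) h'
  have hm : Measurable fun x => ENNReal.ofReal (c x) := hc.measurable.ennreal_ofReal
  have hm' : Measurable fun x => ENNReal.ofReal (c x)⁻¹ := hc'.measurable.ennreal_ofReal
  calc μ.withDensity (fun x => ENNReal.ofReal (c x))
      ≤ (ν.withDensity fun x => ENNReal.ofReal (c x)⁻¹).withDensity
          fun x => ENNReal.ofReal (c x) := by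
        refine Measure.le_iff.2 fun A hA => ?_
        rw [withDensity_apply _ hA, withDensity_apply _ hA]
        exact lintegral_mono' (Measure.restrict_mono le_rfl h2) le_rfl
    _ = ν := by
        rw [← withDensity_mul _ hm' hm]
        convert withDensity_one (μ := ν) using 2
        funext x
        simp [← ENNReal.ofReal_mul (inv_pos.2 (hc0 x)).le, inv_mul_cancel₀ (hc0 x).ne']

end Density

/-! ### Integration against continuous families of measures -/

section FibreIntegral

variable {X U : Type*} [TopologicalSpace X] [MeasurableSpace X] [TopologicalSpace U]
  {p : X → U} {lam : U → Measure X}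

theorem IsContinuousFamily.ae_eq (h : IsContinuousFamily p lam) (u : U) :
    ∀ᵐ x ∂lam u, p x = u := h.concentrated u

theorem IsContinuousFamily.integral_eq_zero (h : IsContinuousFamily p lam) {u : U} {f : X → ℝ}
    (hf : ∀ x, p x = u → f x = 0) : ∫ x, f x ∂lam u = 0 :=
  integral_eq_zero_of_ae (by filter_upwards [h.ae_eq u] with x hx using hf x hx)

/-- This makes the default values in integrands defined by cases harmless: only the fibre counts. -/
theorem IsContinuousFamily.integral_congr (h : IsContinuousFamily p lam) {u : U} {f g : X → ℝ}
    (hf : ∀ x, p x = u → f x = g x) : ∫ x, f x ∂lam u = ∫ x, g x ∂lam u :=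
  integral_congr_ae (by filter_upwards [h.ae_eq u] with x hx using hf x hx)

variable [BorelSpace X] [T2Space X] [LocallyCompactSpace X] [T2Space U]

theorem IsContinuousFamily.integrable (h : IsContinuousFamily p lam) (hp : Continuous p) (u : U)
    {f : X → ℝ} (hf : ContinuousOn f (p ⁻¹' {u})) {K : Set X} (hK : IsCompact K)
    (hfK : ∀ x, p x = u → f x ≠ 0 → x ∈ K) : Integrable f (lam u) := by
  have := h.regular u
  obtain ⟨F, hF⟩ := exists_compactlySupported_eqOn (isClosed_singleton.preimage hp) hK hf hfK
  refine F.integrable.congr ?_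
  filter_upwards [h.ae_eq u] with x hx using hF x hx

/-- Freeze the integrand: extend `F t₀` from its fibre to a compactly supported `F₀`, whose
integrals vary continuously. By compactness `F t` is uniformly close to `F₀` on the fibre over `q t`
for `t` near `t₀`, and the mass of the relevant compact set stays bounded. -/
theorem IsContinuousFamily.continuousAt_integral (h : IsContinuousFamily p lam)
    (hp : Continuous p) {T : Type*} [TopologicalSpace T] {q : T → U} (hq : Continuous q)
    {F : T → X → ℝ} (hF : ContinuousOn (fun a : T × X => F a.1 a.2) {a | p a.2 = q a.1})
    {t₀ : T} {N : Set T} (hN : N ∈ 𝓝 t₀) {K : Set X} (hK : IsCompact K)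
    (hFK : ∀ t ∈ N, ∀ x, p x = q t → F t x ≠ 0 → x ∈ K) :
    ContinuousAt (fun t => ∫ x, F t x ∂lam (q t)) t₀ := by
  have hFt : ∀ t, ContinuousOn (F t) (p ⁻¹' {q t}) := fun t =>
    hF.comp (by fun_prop : ContinuousOn (fun x => (t, x)) _) fun x hx => hx
  obtain ⟨F₀, hF₀⟩ := exists_compactlySupported_eqOn (isClosed_singleton.preimage hp) hK
    (hFt t₀) (hFK t₀ (mem_of_mem_nhds hN))
  have hK₁ : IsCompact (K ∪ tsupport F₀) := hK.union F₀.hasCompactSupport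
  obtain ⟨k, k1, k0, -, -⟩ := exists_compactlySupported_eq_one hK₁ isOpen_univ
    (Set.subset_univ _)
  have hinteg : ∀ f : C_c(X, ℝ), ∀ u, Integrable f (lam u) := fun f u => by
    have := h.regular u
    exact f.integrable
  have hcts : ∀ f : C_c(X, ℝ), Continuous fun t => ∫ x, f x ∂lam (q t) := fun f =>
    (h.continuous_integral f).comp hq
  suffices hlim : Filter.Tendsto
      (fun t => (∫ x, F t x ∂lam (q t)) - ∫ x, F₀ x ∂lam (q t)) (𝓝 t₀) (𝓝 0) by
    have h1 := hlim.add (hcts F₀).continuousAt.tendsto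
    have h2 : ∫ x, F₀ x ∂lam (q t₀) = ∫ x, F t₀ x ∂lam (q t₀) :=
      integral_congr_ae (by filter_upwards [h.ae_eq (q t₀)] with x hx using hF₀ x hx)
    rw [zero_add, h2] at h1
    simpa [ContinuousAt] using h1
  rw [Metric.tendsto_nhds]
  intro ε hε
  -- Adding 1 makes `M` positive and leaves room for it to dominate the integral of `k` throughout a
  -- neighbourhood of `t₀`.
  set M := (∫ x, k x ∂lam (q t₀)) + 1
  have hM : 0 < M := add_pos_of_nonneg_of_pos (integral_nonneg k0) one_pos
  have hunif : ∀ᶠ t in 𝓝 t₀, ∀ x ∈ K ∪ tsupport F₀, p x = q t → |F t x - F₀ x| < ε / M := by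
    refine hK₁.eventually_forall_of_forall_eventually fun x _ => ?_
    by_cases hx : p x = q t₀
    · have hc : ContinuousWithinAt (fun a : T × X => |F a.1 a.2 - F₀ a.2|)
          {a | p a.2 = q a.1} (t₀, x) :=
        ((hF _ hx).sub (F₀.continuous.comp continuous_snd).continuousWithinAt).abs
      have h0 : |F t₀ x - F₀ x| < ε / M := by
        rw [hF₀ x hx, sub_self, abs_zero]; positivity
      have := hc.eventually (gt_mem_nhds h0)
      rwa [eventually_nhdsWithin_iff] at this
    -- Off the fibre over `q t₀` the claim is vacuous nearby, because `U` is Hausdorff.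
    · have : ∀ᶠ a : T × X in 𝓝 (t₀, x), p a.2 ≠ q a.1 :=
        (isOpen_ne_fun (hp.comp continuous_snd) (hq.comp continuous_fst)).mem_nhds hx
      filter_upwards [this] with a ha h' using absurd h' ha
  have hkM : ∀ᶠ t in 𝓝 t₀, ∫ x, k x ∂lam (q t) < M :=
    (hcts k).continuousAt.eventually (gt_mem_nhds (lt_add_one _))
  filter_upwards [hunif, hkM, hN] with t ht hkt htN
  rw [dist_zero_right, ← integral_sub (h.integrable hp _ (hFt t) hK (hFK t htN)) (hinteg F₀ _)]
  calc ‖∫ x, (F t x - F₀ x) ∂lam (q t)‖ ≤ ∫ x, ε / M * k x ∂lam (q t) := by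
        refine norm_integral_le_of_norm_le ((hinteg k _).const_mul _) ?_
        filter_upwards [h.ae_eq (q t)] with x hx
        by_cases hxK : x ∈ K ∪ tsupport F₀
        · rw [k1 x hxK, mul_one]
          exact (ht x hxK hx).le
        · have h1 : F t x = 0 := by
            by_contra h0; exact hxK (.inl (hFK t htN x hx h0))
          have h2 : F₀ x = 0 := image_eq_zero_of_notMem_tsupport fun h' => hxK (.inr h')
          rw [h1, h2, sub_self, norm_zero]
          exact mul_nonneg (by positivity) (k0 x)
    _ = ε / M * ∫ x, k x ∂lam (q t) := integral_const_mul _ _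
    _ < ε / M * M := by gcongr
    _ = ε := div_mul_cancel₀ _ hM.ne'

theorem IsContinuousFamily.continuous_fibre_integral (h : IsContinuousFamily p lam)
    (hp : Continuous p) {T : Type*} [TopologicalSpace T] {q : T → U} (hq : Continuous q)
    {F : T → X → ℝ} (hF : ContinuousOn (fun a : T × X => F a.1 a.2) {a | p a.2 = q a.1})
    (hFK : ∀ t₀, ∃ N ∈ 𝓝 t₀, ∃ K, IsCompact K ∧
      ∀ t ∈ N, ∀ x, p x = q t → F t x ≠ 0 → x ∈ K) :
    Continuous fun t => ∫ x, F t x ∂lam (q t) := by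
  rw [continuous_iff_continuousAt]
  intro t₀
  obtain ⟨N, hN, K, hK, hFK⟩ := hFK t₀
  exact h.continuousAt_integral hp hq hF hN hK hFK

/-- On the product of the two fibres `F` agrees with a compactly supported continuous function on `X
× Y`; for such functions Fubini holds for measures finite on compact sets. -/
theorem IsContinuousFamily.integral_swap {Y V : Type*} [TopologicalSpace Y] [MeasurableSpace Y]
    [BorelSpace Y] [T2Space Y] [LocallyCompactSpace Y] [TopologicalSpace V] [T2Space V]
    {q : Y → V} {nu : V → Measure Y} (h : IsContinuousFamily p lam) (hp : Continuous p)
    (h' : IsContinuousFamily q nu) (hq : Continuous q) {u : U} {v : V} {F : X → Y → ℝ}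
    (hF : ContinuousOn (fun a : X × Y => F a.1 a.2) {a | p a.1 = u ∧ q a.2 = v})
    {K : Set X} {L : Set Y} (hK : IsCompact K) (hL : IsCompact L)
    (hFK : ∀ x y, p x = u → q y = v → F x y ≠ 0 → x ∈ K ∧ y ∈ L) :
    ∫ x, ∫ y, F x y ∂nu v ∂lam u = ∫ y, ∫ x, F x y ∂lam u ∂nu v := by
  have := h.regular u
  have := h'.regular v
  have hcl : IsClosed {a : X × Y | p a.1 = u ∧ q a.2 = v} :=
    (isClosed_eq (hp.comp continuous_fst) continuous_const).inter
      (isClosed_eq (hq.comp continuous_snd) continuous_const)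
  obtain ⟨f, hf⟩ := exists_compactlySupported_eqOn hcl (hK.prod hL) hF
    (fun a ha h0 => hFK a.1 a.2 ha.1 ha.2 h0)
  calc ∫ x, ∫ y, F x y ∂nu v ∂lam u = ∫ x, ∫ y, f (x, y) ∂nu v ∂lam u :=
        h.integral_congr fun x hx => h'.integral_congr fun y hy => (hf (x, y) ⟨hx, hy⟩).symm
    _ = ∫ y, ∫ x, f (x, y) ∂lam u ∂nu v :=
        integral_integral_swap_of_hasCompactSupport (f := fun x y => f (x, y))
          f.continuous f.hasCompactSupport
    _ = _ :=
        h'.integral_congr fun y hy => h.integral_congr fun x hx => hf (x, y) ⟨hx, hy⟩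

end FibreIntegral

/-! ### Consequences of the Haar system for the groupoid -/

section Groupoid

variable {G U : Type*} [TopologicalSpace G] [TopologicalSpace U]

theorem TopGroupoid.t2Space_units [T2Space G] (𝓖 : TopGroupoid G U) : T2Space U :=
  T2Space.of_injective_continuous (f := 𝓖.one) (Function.LeftInverse.injective 𝓖.r_one)
    𝓖.continuous_one

theorem TopGroupoid.inv_inv (𝓖 : TopGroupoid G U) (a : G) : 𝓖.inv (𝓖.inv a) = a := by
  refine (𝓖.eq_inv (𝓖.r_inv a).symm ?_).symm
  rw [𝓖.mul_inv, 𝓖.s_inv]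

/-- A bump function at `g` supported in `V` has positive integral over the fibre of `r g`, by full
support. By continuity the integral remains positive over nearby units, so their fibres meet `V`. -/
theorem HaarGroupoid.isOpenMap_r [T2Space G] [LocallyCompactSpace G] [MeasurableSpace G]
    [BorelSpace G] (𝓖 : HaarGroupoid G U) : IsOpenMap 𝓖.r := by
  refine isOpenMap_iff_nhds_le.2 fun g => ?_
  intro W hW
  obtain ⟨V, hVW, hV, hgV⟩ := mem_nhds_iff.1 (Filter.mem_map.1 hW)
  obtain ⟨f, f1, f0, -, fV⟩ := exists_compactlySupported_eq_one (isCompact_singleton (x := g)) hV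
    (by simpa using hgV)
  have := 𝓖.haar_family.regular
  have hpos : 0 < ∫ x, f x ∂𝓖.haar (𝓖.r g) := by
    rw [integral_pos_iff_support_of_nonneg f0 f.integrable]
    exact 𝓖.haar_full _ _ f.continuous.isOpen_support
      ⟨g, by simp [f1 g rfl], rfl⟩
  filter_upwards [(𝓖.haar_family.continuous_integral f).continuousAt.eventually
    (lt_mem_nhds hpos)] with u hu
  by_contra hcon
  refine hu.ne' (𝓖.haar_family.integral_eq_zero fun x hx => ?_)
  by_contra h0
  exact hcon (hx ▸ hVW (fV x h0))

end Groupoid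

/-! ### Actions extended to all pairs, and properness -/

section TotalActions

variable {H V Z : Type*} [TopologicalSpace H] [TopologicalSpace V]

open Classical in
/-- A right action, extended by `(x, g) ↦ x` to pairs that are not composable. -/
def RightAction.tact {𝓗 : TopGroupoid H V} (R : RightAction 𝓗 Z) (x : Z) (g : H) : Z :=
  if h : R.mom x = 𝓗.r g then R.act x g h else x

theorem RightAction.tact_eq {𝓗 : TopGroupoid H V} (R : RightAction 𝓗 Z) {x : Z} {g : H}
    (h : R.mom x = 𝓗.r g) : R.tact x g = R.act x g h := dif_pos h

open Classical in
/-- A left action, extended by `(g, x) ↦ x` to pairs that are not composable. -/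
def LeftAction.tact {𝓗 : TopGroupoid H V} (L : LeftAction 𝓗 Z) (g : H) (x : Z) : Z :=
  if h : 𝓗.s g = L.mom x then L.act g x h else x

theorem LeftAction.tact_eq {𝓗 : TopGroupoid H V} (L : LeftAction 𝓗 Z) {x : Z} {g : H}
    (h : 𝓗.s g = L.mom x) : L.tact g x = L.act g x h := dif_pos h

theorem RightAction.tact_act {𝓗 : TopGroupoid H V} (R : RightAction 𝓗 Z) {z : Z} {a b : H}
    (h : R.mom z = 𝓗.r a) (hab : 𝓗.s a = 𝓗.r b) :
    R.tact (R.act z a h) b = R.tact z (𝓗.mul a b hab) := by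
  rw [R.tact_eq ((R.mom_act z a h).trans hab), R.tact_eq (h.trans (𝓗.r_mul a b hab).symm),
    R.act_mul]

theorem LeftAction.mom_tact_inv {𝓗 : TopGroupoid H V} (L : LeftAction 𝓗 Z) {g : H} {z : Z}
    (h : 𝓗.r g = L.mom z) : 𝓗.s g = L.mom (L.tact (𝓗.inv g) z) := by
  rw [L.tact_eq ((𝓗.s_inv g).trans h), L.mom_act, 𝓗.r_inv]

theorem LeftAction.tact_tact_inv {𝓗 : TopGroupoid H V} (L : LeftAction 𝓗 Z) {g : H} {z : Z}
    (h : 𝓗.r g = L.mom z) : L.tact g (L.tact (𝓗.inv g) z) = z := by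
  rw [L.tact_eq (L.mom_tact_inv h)]
  have h' : 𝓗.s (𝓗.inv g) = L.mom z := (𝓗.s_inv g).trans h
  have := L.mul_act g (𝓗.inv g) z (𝓗.r_inv g).symm h'
  rw [L.act_of_eq_one (𝓗.mul_inv g)] at this
  rw [L.act_congr rfl (L.tact_eq h') _ ((𝓗.r_inv g).symm.trans (L.mom_act _ _ h').symm), ← this]

variable [TopologicalSpace Z]

theorem RightAction.IsContinuous.continuousOn_tact {𝓗 : TopGroupoid H V} {R : RightAction 𝓗 Z}
    (hR : R.IsContinuous) :
    ContinuousOn (fun a : Z × H => R.tact a.1 a.2) {a | R.mom a.1 = 𝓗.r a.2} := by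
  rw [continuousOn_iff_continuous_domRestrict]
  exact hR.act.congr fun a => (R.tact_eq a.2).symm

theorem LeftAction.IsContinuous.continuousOn_tact {𝓗 : TopGroupoid H V} {L : LeftAction 𝓗 Z}
    (hL : L.IsContinuous) :
    ContinuousOn (fun a : H × Z => L.tact a.1 a.2) {a | 𝓗.s a.1 = L.mom a.2} := by
  rw [continuousOn_iff_continuous_domRestrict]
  exact hL.act.congr fun a => (L.tact_eq a.2).symm

theorem RightAction.IsProper.exists_isCompact {𝓗 : TopGroupoid H V} {R : RightAction 𝓗 Z}
    (hR : R.IsProper) {C₁ C₂ : Set Z} (h₁ : IsCompact C₁) (h₂ : IsCompact C₂) :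
    ∃ L : Set H, IsCompact L ∧ ∀ x g (h : R.mom x = 𝓗.r g), x ∈ C₁ → R.act x g h ∈ C₂ → g ∈ L := by
  refine ⟨(fun a : R.Trans => a.1.2) '' _,
    ((IsProperMap.isCompact_preimage hR (h₁.prod h₂)).image (by fun_prop)), ?_⟩
  exact fun x g h hx hxg => ⟨⟨(x, g), h⟩, ⟨hx, hxg⟩, rfl⟩

/-- In a locally compact Hausdorff target, properness means that preimages of compact sets are
compact. Confining the acting element to a compact set suffices, since the composable pairs form a
closed set. Properness passes to Z and to Ω through this criterion. -/
theorem RightAction.isProper_of_exists_isCompact [T2Space V] [T2Space Z] [LocallyCompactSpace Z]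
    {𝓗 : TopGroupoid H V} {R : RightAction 𝓗 Z} (hc : R.IsContinuous)
    (h : ∀ C₁ C₂ : Set Z, IsCompact C₁ → IsCompact C₂ →
      ∃ L : Set H, IsCompact L ∧
        ∀ x g (h : R.mom x = 𝓗.r g), x ∈ C₁ → R.act x g h ∈ C₂ → g ∈ L) :
    R.IsProper := by
  have hcont : Continuous fun p : R.Trans => ((p.1.1, R.act p.1.1 p.1.2 p.2) : Z × Z) :=
    (continuous_fst.comp continuous_subtype_val).prodMk hc.act
  refine isProperMap_iff_isCompact_preimage.2 ⟨hcont, fun K hK => ?_⟩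
  obtain ⟨L, hL, hL'⟩ := h _ _ (hK.image continuous_fst) (hK.image continuous_snd)
  have hcl : IsClosed {p : Z × H | R.mom p.1 = 𝓗.r p.2} :=
    isClosed_eq (hc.mom.comp continuous_fst) (𝓗.continuous_r.comp continuous_snd)
  have hcpt : IsCompact (Subtype.val ⁻¹' ((Prod.fst '' K) ×ˢ L) : Set R.Trans) :=
    hcl.isClosedEmbedding_subtypeVal.isCompact_preimage ((hK.image continuous_fst).prod hL)
  refine hcpt.of_isClosed_subset (hK.isClosed.preimage hcont) fun p hp => ?_
  have h1 : p.1.1 ∈ Prod.fst '' K := ⟨_, hp, rfl⟩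
  exact ⟨h1, hL' _ _ p.2 h1 ⟨_, hp, rfl⟩⟩

end TotalActions

/-! ### Orbit maps of proper actions -/

section OrbitMaps

variable {H V Z Ω : Type*} [TopologicalSpace H] [TopologicalSpace V] [TopologicalSpace Z]
  [TopologicalSpace Ω]

/-- The map `π` is an open quotient map whose fibres are the orbits of the action `R`. -/
structure RightAction.IsOrbitMap {𝓗 : TopGroupoid H V} (R : RightAction 𝓗 Z) (π : Z → Ω) :
    Prop where
  isOpenQuotientMap : IsOpenQuotientMap π
  eq_iff : ∀ z w, π z = π w ↔ ∃ (g : H) (h : R.mom z = 𝓗.r g), w = R.act z g h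

namespace RightAction

/-- If z g lies in the open set `W`, then y g' does too for (y, g') composable and close to (z, g).
Openness of the range map supplies such a g' for every y near z, so the saturation of `W` is open.
-/
theorem isOpenMap_of_isQuotientMap {𝓗 : TopGroupoid H V} {R : RightAction 𝓗 Z}
    (hr : IsOpenMap 𝓗.r) (hR : R.IsContinuous) {π : Z → Ω} (hπ : IsQuotientMap π)
    (h : ∀ z w, π z = π w ↔ ∃ (g : H) (h : R.mom z = 𝓗.r g), w = R.act z g h) :
    IsOpenMap π := by
  intro W hW
  rw [← hπ.isOpen_preimage, isOpen_iff_mem_nhds]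
  rintro z ⟨w, hw, hwz⟩
  obtain ⟨g, hg, rfl⟩ := (h z w).1 hwz.symm
  have hc := hR.continuousOn_tact (z, g) hg
  have hev := hc (hW.mem_nhds (show R.tact z g ∈ W by rwa [R.tact_eq hg]))
  rw [Filter.mem_map, mem_nhdsWithin_iff_exists_mem_nhds_inter] at hev
  obtain ⟨A, hA, hA'⟩ := hev
  obtain ⟨N₁, hN₁, N₂, hN₂, hN⟩ := mem_nhds_prod_iff.1 hA
  have h1 : 𝓗.r '' N₂ ∈ 𝓝 (R.mom z) := hg ▸ hr.image_mem_nhds hN₂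
  filter_upwards [hN₁, hR.mom.continuousAt h1] with y hy1 hy2
  obtain ⟨g', hg', hy⟩ := hy2
  have h3 : R.tact y g' ∈ W := @hA' (y, g') ⟨hN ⟨hy1, hg'⟩, hy.symm⟩
  refine ⟨_, h3, ((h _ _).2 ⟨g', hy.symm, R.tact_eq _⟩).symm⟩

/-- For an open quotient map, Hausdorffness amounts to closedness of the orbit relation, which is
the range of the proper map (z, g) ↦ (z, zg). -/
theorem IsOrbitMap.t2Space {𝓗 : TopGroupoid H V} {R : RightAction 𝓗 Z} (hP : R.IsProper)
    {π : Z → Ω} (hπ : R.IsOrbitMap π) : T2Space Ω := by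
  rw [t2Space_iff_of_isOpenQuotientMap hπ.isOpenQuotientMap]
  convert IsProperMap.isClosedMap hP |>.isClosed_range using 1
  ext ⟨z, w⟩
  refine (hπ.eq_iff z w).trans ⟨?_, ?_⟩
  · rintro ⟨g, h, rfl⟩
    exact ⟨⟨(z, g), h⟩, rfl⟩
  · rintro ⟨⟨⟨z', g⟩, h⟩, heq⟩
    obtain ⟨rfl, rfl⟩ := Prod.mk.inj heq
    exact ⟨g, h, rfl⟩

theorem IsOrbitMap.exists_isCompact_lift [LocallyCompactSpace Z] {𝓗 : TopGroupoid H V}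
    {R : RightAction 𝓗 Z} {π : Z → Ω} (hπ : R.IsOrbitMap π) {K : Set Ω} (hK : IsCompact K) :
    ∃ C : Set Z, IsCompact C ∧ K ⊆ π '' C := by
  choose σ hσ using hπ.isOpenQuotientMap.surjective
  choose N hN hN' using fun z : Z => exists_compact_mem_nhds z
  have hnhds : ∀ ω ∈ K, π '' N (σ ω) ∈ 𝓝 ω := fun ω _ => by
    have := hπ.isOpenQuotientMap.isOpenMap.image_mem_nhds (hN' (σ ω))
    rwa [hσ] at this
  obtain ⟨t, -, ht⟩ := hK.elim_nhds_subcover _ hnhds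
  refine ⟨⋃ ω ∈ t, N (σ ω), t.isCompact_biUnion fun ω _ => hN _, fun ω hω => ?_⟩
  obtain ⟨i, hi, z, hz, rfl⟩ := Set.mem_iUnion₂.1 (ht hω)
  exact ⟨z, Set.mem_biUnion hi hz, rfl⟩

end RightAction

/-- A function on `Z` whose support meets the preimage of every compact set in a relatively compact
set. -/
def HasFibrewiseCompactSupport (π : Z → Ω) (F : Z → ℝ) : Prop :=
  ∀ K : Set Ω, IsCompact K → ∃ C : Set Z, IsCompact C ∧ ∀ z, π z ∈ K → F z ≠ 0 → z ∈ C

theorem HasFibrewiseCompactSupport.mono {π : Z → Ω} {F F' : Z → ℝ}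
    (hF : HasFibrewiseCompactSupport π F) (h : ∀ z, F' z ≠ 0 → F z ≠ 0) :
    HasFibrewiseCompactSupport π F' := fun K hK => by
  obtain ⟨C, hC, hC'⟩ := hF K hK
  exact ⟨C, hC, fun z hz h0 => hC' z hz (h z h0)⟩

namespace RightAction

/-- If ζ(t) stays in a compact set and ζ(t) g meets the support of `F`, both ends of g are confined
to compact sets, so properness confines g. This is the support hypothesis of
`continuous_fibre_integral`. -/
theorem IsOrbitMap.exists_nhds_isCompact [LocallyCompactSpace Z] {𝓗 : TopGroupoid H V}
    {R : RightAction 𝓗 Z} (hP : R.IsProper) {π : Z → Ω} (hπ : R.IsOrbitMap π) {F : Z → ℝ}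
    (hF : HasFibrewiseCompactSupport π F) {T : Type*} [TopologicalSpace T] {ζ : T → Z}
    (hζ : Continuous ζ) (t₀ : T) :
    ∃ N ∈ 𝓝 t₀, ∃ K : Set H, IsCompact K ∧
      ∀ t ∈ N, ∀ g, 𝓗.r g = R.mom (ζ t) → F (R.tact (ζ t) g) ≠ 0 → g ∈ K := by
  obtain ⟨N, hN, hN'⟩ := exists_compact_mem_nhds (ζ t₀)
  obtain ⟨C, hC, hC'⟩ := hF _ (hN.image hπ.isOpenQuotientMap.continuous)
  obtain ⟨K, hK, hK'⟩ := hP.exists_isCompact hN hC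
  refine ⟨ζ ⁻¹' N, hζ.continuousAt hN', K, hK, fun t ht g hg h0 => ?_⟩
  refine hK' _ g hg.symm ht ?_
  rw [← R.tact_eq]
  refine hC' _ ⟨ζ t, ht, ?_⟩ h0
  exact (hπ.eq_iff _ _).2 ⟨g, hg.symm, R.tact_eq _⟩

theorem IsOrbitMap.exists_isCompact [LocallyCompactSpace Z] {𝓗 : TopGroupoid H V}
    {R : RightAction 𝓗 Z} (hP : R.IsProper) {π : Z → Ω} (hπ : R.IsOrbitMap π) {F : Z → ℝ}
    (hF : HasFibrewiseCompactSupport π F) (z : Z) :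
    ∃ K : Set H, IsCompact K ∧ ∀ g, 𝓗.r g = R.mom z → F (R.tact z g) ≠ 0 → g ∈ K := by
  obtain ⟨N, hN, K, hK, hK'⟩ := hπ.exists_nhds_isCompact hP hF continuous_id z
  exact ⟨K, hK, hK' z (mem_of_mem_nhds hN)⟩

theorem IsContinuous.continuousOn_tact_left {𝓗 : TopGroupoid H V} {R : RightAction 𝓗 Z}
    (hR : R.IsContinuous) (z : Z) : ContinuousOn (R.tact z) (𝓗.r ⁻¹' {R.mom z}) :=
  hR.continuousOn_tact.comp (by fun_prop : ContinuousOn (fun g => (z, g)) _)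
    fun _ hg => Eq.symm hg

end RightAction

end OrbitMaps

/-! ### Orbit integrals and cutoff functions -/

section OrbitIntegral

variable {H V Z Ω : Type*} [TopologicalSpace H] [TopologicalSpace V] [MeasurableSpace H]
  {𝓗 : HaarGroupoid H V} {R : RightAction 𝓗.toTopGroupoid Z}

variable (𝓗 R) in
/-- The integral of a function over the orbit of a point. -/
def orbInt (F : Z → ℝ) (z : Z) : ℝ := ∫ g, F (R.tact z g) ∂𝓗.haar (R.mom z)

theorem orbInt_mul_comp [TopologicalSpace Z] [TopologicalSpace Ω] {π : Z → Ω} (hπ : R.IsOrbitMap π)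
    (F : Z → ℝ) (k : Ω → ℝ) (z : Z) :
    orbInt 𝓗 R (fun w => F w * k (π w)) z = orbInt 𝓗 R F z * k (π z) := by
  rw [orbInt, orbInt, ← integral_mul_const]
  refine 𝓗.haar_family.integral_congr fun g hg => ?_
  have : π z = π (R.tact z g) := (hπ.eq_iff _ _).2 ⟨g, hg.symm, R.tact_eq _⟩
  rw [this]

variable [T2Space H] [LocallyCompactSpace H]

/-- Left invariance of the Haar system, tested on a compactly supported extension of g ↦ F(zg).
Regularity is required along a single orbit only, since `compositeWeight` will be controlled only
where its arguments are composable. -/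
theorem orbInt_act {F : Z → ℝ} {z : Z}
    (hF : ContinuousOn (fun g => F (R.tact z g)) (𝓗.r ⁻¹' {R.mom z})) {K : Set H}
    (hK : IsCompact K) (hFK : ∀ g, 𝓗.r g = R.mom z → F (R.tact z g) ≠ 0 → g ∈ K) (g : H)
    (h : R.mom z = 𝓗.r g) : orbInt 𝓗 R F (R.act z g h) = orbInt 𝓗 R F z := by
  have := 𝓗.t2Space_units
  obtain ⟨f, hf⟩ := exists_compactlySupported_eqOn (isClosed_singleton.preimage 𝓗.continuous_r)
    hK hF hFK
  have hinv := 𝓗.haar_invariant g f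
  have h2 : orbInt 𝓗 R F z = ∫ x, f x ∂𝓗.haar (𝓗.r g) := by
    rw [orbInt, ← h]
    exact 𝓗.haar_family.integral_congr fun x hx => (hf x hx).symm
  rw [h2, ← hinv, orbInt, R.mom_act]
  refine 𝓗.haar_family.integral_congr fun x hx => ?_
  rw [dif_pos hx.symm, hf _ ((𝓗.r_mul _ _ _).trans h.symm), R.tact_act]

variable [TopologicalSpace Z] [TopologicalSpace Ω]

theorem orbInt_eq_of_proj_eq {π : Z → Ω} (hπ : R.IsOrbitMap π) {F : Z → ℝ} {z w : Z}
    (hF : ContinuousOn (fun g => F (R.tact z g)) (𝓗.r ⁻¹' {R.mom z})) {K : Set H}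
    (hK : IsCompact K) (hFK : ∀ g, 𝓗.r g = R.mom z → F (R.tact z g) ≠ 0 → g ∈ K)
    (h : π z = π w) : orbInt 𝓗 R F z = orbInt 𝓗 R F w := by
  obtain ⟨g, hg, rfl⟩ := (hπ.eq_iff _ _).1 h
  exact (orbInt_act hF hK hFK g hg).symm

variable [LocallyCompactSpace Z]

theorem orbInt_eq (hR : R.IsContinuous) (hP : R.IsProper) {π : Z → Ω}
    (hπ : R.IsOrbitMap π) {F : Z → ℝ} (hF : Continuous F)
    (hF' : HasFibrewiseCompactSupport π F) {z w : Z} (h : π z = π w) :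
    orbInt 𝓗 R F z = orbInt 𝓗 R F w := by
  obtain ⟨K, hK, hK'⟩ := hπ.exists_isCompact hP hF' z
  exact orbInt_eq_of_proj_eq hπ (hF.comp_continuousOn (hR.continuousOn_tact_left z)) hK hK' h

variable [BorelSpace H]

theorem continuous_orbInt (hR : R.IsContinuous) (hP : R.IsProper) {π : Z → Ω}
    (hπ : R.IsOrbitMap π) {F : Z → ℝ} (hF : Continuous F)
    (hF' : HasFibrewiseCompactSupport π F) : Continuous (orbInt 𝓗 R F) := by
  have := 𝓗.t2Space_units
  refine 𝓗.haar_family.continuous_fibre_integral 𝓗.continuous_r hR.mom ?_ fun z =>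
    hπ.exists_nhds_isCompact hP hF' continuous_id z
  exact hF.comp_continuousOn (hR.continuousOn_tact.mono fun a ha => Eq.symm ha)

theorem orbInt_pos (hR : R.IsContinuous) (hP : R.IsProper) {π : Z → Ω}
    (hπ : R.IsOrbitMap π) {F : Z → ℝ} (hF : Continuous F)
    (hF' : HasFibrewiseCompactSupport π F) (hF0 : ∀ z, 0 ≤ F z) {z w : Z} (h : π z = π w)
    (hw : F w ≠ 0) : 0 < orbInt 𝓗 R F z := by
  have := 𝓗.t2Space_units
  have := 𝓗.haar_family.regular
  obtain ⟨g, hg, rfl⟩ := (hπ.eq_iff _ _).1 h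
  obtain ⟨K, hK, hK'⟩ := hπ.exists_isCompact hP hF' z
  obtain ⟨f, hf⟩ := exists_compactlySupported_eqOn (isClosed_singleton.preimage 𝓗.continuous_r)
    hK (hF.comp_continuousOn (hR.continuousOn_tact_left z)) hK'
  have h2 : orbInt 𝓗 R F z = ∫ x, f x ∂𝓗.haar (R.mom z) :=
    𝓗.haar_family.integral_congr fun x hx => (hf x hx).symm
  rw [h2, integral_pos_iff_support_of_nonneg_ae ?_ f.integrable]
  · refine 𝓗.haar_full _ _ f.continuous.isOpen_support ⟨g, ?_, hg.symm⟩
    rw [Function.mem_support, hf g hg.symm, Function.comp_apply, R.tact_eq hg]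
    exact hw
  · filter_upwards [𝓗.haar_family.ae_eq (R.mom z)] with x hx
    rw [hf x hx]
    exact hF0 _

/-- A cutoff function for the orbit map of a proper groupoid action. -/
structure IsCutoff (𝓗 : HaarGroupoid H V) (R : RightAction 𝓗.toTopGroupoid Z) (π : Z → Ω)
    (φ : Z → ℝ) : Prop where
  continuous : Continuous φ
  nonneg : ∀ z, 0 ≤ φ z
  hasFibrewiseCompactSupport : HasFibrewiseCompactSupport π φ
  orbInt_eq_one : ∀ z, orbInt 𝓗 R φ z = 1

/-- Bump functions on Z are glued by a partition of unity on Ω, which is where paracompactness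
enters. The sum has positive orbit integrals, and dividing by them normalises it. -/
theorem exists_isCutoff [T2Space Z] [T2Space Ω] [ParacompactSpace Ω] (hR : R.IsContinuous)
    (hP : R.IsProper) {π : Z → Ω} (hπ : R.IsOrbitMap π) : ∃ φ, IsCutoff 𝓗 R π φ := by
  have := 𝓗.t2Space_units
  have hπc := hπ.isOpenQuotientMap.continuous
  choose σ hσ using hπ.isOpenQuotientMap.surjective
  choose f f1 f0 _ _ using fun z : Z =>
    exists_compactlySupported_eq_one (isCompact_singleton (x := z)) isOpen_univ
      (Set.subset_univ _)
  let W : Ω → Set Ω := fun ω => π '' {z | f (σ ω) z ≠ 0}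
  have hWo : ∀ ω, IsOpen (W ω) := fun ω =>
    hπ.isOpenQuotientMap.isOpenMap _ (f (σ ω)).continuous.isOpen_support
  have hWc : Set.univ ⊆ ⋃ ω, W ω := fun ω _ =>
    Set.mem_iUnion.2 ⟨ω, σ ω, by simp [f1 (σ ω) _ rfl], hσ ω⟩
  obtain ⟨ρ, hρ⟩ := PartitionOfUnity.exists_isSubordinate isClosed_univ W hWo hWc
  let φ : Z → ℝ := fun z => ∑ᶠ ω, ρ ω (π z) * f (σ ω) z
  have hlf : LocallyFinite fun ω => Function.support fun z => ρ ω (π z) * f (σ ω) z := by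
    refine (ρ.locallyFinite.preimage_continuous hπc).subset fun ω z hz => ?_
    exact left_ne_zero_of_mul hz
  have hφc : Continuous φ := continuous_finsum
    (fun ω => ((ρ ω).continuous.comp hπc).mul (f (σ ω)).continuous) hlf
  have hφ0 : ∀ z, 0 ≤ φ z := fun z =>
    finsum_nonneg fun ω => mul_nonneg (ρ.nonneg ω _) (f0 _ _)
  have hφs : HasFibrewiseCompactSupport π φ := by
    intro K hK
    -- Over a compact set only finitely many members of the partition contribute, so finitely many
    -- bump supports suffice.
    have hfin := ρ.locallyFinite.finite_nonempty_inter_compact hK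
    refine ⟨⋃ ω ∈ hfin.toFinset, tsupport (f (σ ω)),
      hfin.toFinset.isCompact_biUnion fun ω _ => (f (σ ω)).hasCompactSupport, fun z hz h0 => ?_⟩
    obtain ⟨ω, hω⟩ : ∃ ω, ρ ω (π z) * f (σ ω) z ≠ 0 := by
      by_contra! hcon
      exact h0 ((finsum_congr hcon).trans finsum_zero)
    refine Set.mem_biUnion (x := ω) ?_ (subset_tsupport _ (right_ne_zero_of_mul hω))
    simp only [Set.Finite.coe_toFinset, Set.mem_ofPred_eq]
    exact ⟨π z, left_ne_zero_of_mul hω, hz⟩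
  have hpos : ∀ z, 0 < orbInt 𝓗 R φ z := by
    intro z
    -- Some `ρ ω` is positive at π(z); subordination then provides a point `w` of the same orbit at
    -- which the corresponding bump is nonzero.
    obtain ⟨ω, hω⟩ := ρ.exists_pos (Set.mem_univ (π z))
    obtain ⟨w, hw, hwz⟩ := hρ ω (subset_tsupport _ hω.ne')
    refine orbInt_pos hR hP hπ hφc hφs hφ0 hwz.symm (ne_of_gt ?_)
    refine lt_of_lt_of_le ?_ (single_le_finsum ω (hlf.point_finite w)
      fun ω => mul_nonneg (ρ.nonneg ω _) (f0 _ _))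
    exact mul_pos (hwz ▸ hω) (lt_of_le_of_ne (f0 _ _) (Ne.symm hw))
  have hcont := continuous_orbInt hR hP hπ hφc hφs
  refine ⟨fun z => φ z * (orbInt 𝓗 R φ z)⁻¹, ?_, ?_, ?_, fun z => ?_⟩
  · exact hφc.mul (hcont.inv₀ fun z => (hpos z).ne')
  · exact fun z => mul_nonneg (hφ0 z) (inv_nonneg.2 (hpos z).le)
  · exact hφs.mono fun z hz => left_ne_zero_of_mul hz
  -- The normalising factor is constant on orbits; writing it through the section `σ` exhibits it as
  -- a function of π(z), which can be pulled out of the orbit integral.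
  · have h1 := orbInt_mul_comp (𝓗 := 𝓗) hπ φ (fun ω => (orbInt 𝓗 R φ (σ ω))⁻¹) z
    have h2 : ∀ w, orbInt 𝓗 R φ (σ (π w)) = orbInt 𝓗 R φ w := fun w =>
      orbInt_eq hR hP hπ hφc hφs (hσ (π w))
    simp only [h2] at h1
    rw [h1, mul_inv_cancel₀ (hpos z).ne']

end OrbitIntegral

/-- Openness is essential: open quotient maps, unlike general ones, restrict to quotient maps over
arbitrary subsets. Continuity on sets of composable pairs descends to Ω in this way. -/
theorem IsOpenQuotientMap.continuousOn_of_comp {A B C : Type*} [TopologicalSpace A]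
    [TopologicalSpace B] [TopologicalSpace C] {q : A → B} (hq : IsOpenQuotientMap q) {f : B → C}
    {S : Set B} (hf : ContinuousOn (fun a => f (q a)) (q ⁻¹' S)) : ContinuousOn f S := by
  rw [continuousOn_iff_continuous_domRestrict] at hf ⊢
  exact (hq.restrictPreimage S).continuous_comp_iff.1 hf

/-! ### The fibre product and its orbit space as bispaces -/

section Composite

variable {G₁ U₁ G₂ U₂ G₃ U₃ X Y : Type*}
  [TopologicalSpace G₁] [TopologicalSpace U₁] [TopologicalSpace G₂] [TopologicalSpace U₂]
  [TopologicalSpace G₃] [TopologicalSpace U₃]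
  {𝓖₁ : TopGroupoid G₁ U₁} {𝓖₂ : TopGroupoid G₂ U₂} {𝓖₃ : TopGroupoid G₃ U₃}
  (A : Bispace 𝓖₁ 𝓖₂ X) (B : Bispace 𝓖₂ 𝓖₃ Y)

namespace FibreProd

/-- The diagonal action of the middle groupoid on the fibre product. -/
def diagAction : RightAction 𝓖₂ (FibreProd A B) where
  mom := mom
  act := diag
  mom_act _ _ _ := A.right.mom_act _ _ _
  act_one z := ext' (A.right.act_of_eq_one rfl _) (B.left.act_of_eq_one (𝓖₂.inv_one _) _)
  act_mul z g g' h hg := by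
    refine ext' (A.right.act_mul z.fst g g' h hg) ?_
    have hab : 𝓖₂.s (𝓖₂.inv g') = 𝓖₂.r (𝓖₂.inv g) :=
      (𝓖₂.s_inv g').trans (hg.symm.trans (𝓖₂.r_inv g).symm)
    refine Eq.trans ?_ (B.left.mul_act (𝓖₂.inv g') (𝓖₂.inv g) z.snd hab (z.s_inv_eq g h))
    exact B.left.act_congr (𝓖₂.inv_mul_rev g g' hg) rfl _ _

/-- The action of the first groupoid on the fibre product. -/
def leftAction : LeftAction 𝓖₁ (FibreProd A B) where
  mom z := A.left.mom z.fst
  act := leftAct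
  mom_act _ _ _ := A.left.mom_act _ _ _
  one_act _ := ext' (A.left.one_act _) rfl
  mul_act _ _ _ hab h := ext' (A.left.mul_act _ _ _ hab h) rfl

/-- The action of the third groupoid on the fibre product. -/
def rightAction : RightAction 𝓖₃ (FibreProd A B) where
  mom z := B.right.mom z.snd
  act := rightAct
  mom_act _ _ _ := B.right.mom_act _ _ _
  act_one _ := ext' rfl (B.right.act_one _)
  act_mul _ _ _ h hab := ext' rfl (B.right.act_mul _ _ _ h hab)

variable {A B}

/-- The default off composable pairs is to fix the point, both on Z and on Ω, so no composability is
needed. -/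
theorem proj_leftAction_tact (g : G₁) (z : FibreProd A B) :
    OrbitSpace.proj ((leftAction A B).tact g z) =
      OrbitSpace.leftActAux g (OrbitSpace.proj z) := by
  by_cases h : 𝓖₁.s g = A.left.mom z.fst
  · rw [OrbitSpace.leftActAux_proj g z h, (leftAction A B).tact_eq h]; rfl
  · have h2 : OrbitSpace.leftActAux g (OrbitSpace.proj z) = OrbitSpace.proj z := dif_neg h
    exact (congrArg _ (dif_neg h)).trans h2.symm

theorem proj_rightAction_tact (z : FibreProd A B) (g : G₃) :
    OrbitSpace.proj ((rightAction A B).tact z g) =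
      OrbitSpace.rightActAux (OrbitSpace.proj z) g := by
  by_cases h : B.right.mom z.snd = 𝓖₃.r g
  · rw [OrbitSpace.rightActAux_proj z g h, (rightAction A B).tact_eq h]; rfl
  · have h2 : OrbitSpace.rightActAux (OrbitSpace.proj z) g = OrbitSpace.proj z := dif_neg h
    exact (congrArg _ (dif_neg h)).trans h2.symm

variable [TopologicalSpace X] [TopologicalSpace Y]

theorem continuous_fst' : Continuous (fst : FibreProd A B → X) :=
  continuous_fst.comp continuous_subtype_val

theorem continuous_snd' : Continuous (snd : FibreProd A B → Y) :=
  continuous_snd.comp continuous_subtype_val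

instance [T2Space X] [T2Space Y] : T2Space (FibreProd A B) :=
  inferInstanceAs (T2Space {p : X × Y // A.right.mom p.1 = B.left.mom p.2})

theorem isClosed_range [T2Space U₂] (hA : A.right.IsContinuous) (hB : B.left.IsContinuous) :
    IsClosed {p : X × Y | A.right.mom p.1 = B.left.mom p.2} :=
  isClosed_eq (hA.mom.comp continuous_fst) (hB.mom.comp continuous_snd)

theorem locallyCompactSpace [T2Space U₂] [LocallyCompactSpace X] [LocallyCompactSpace Y]
    (hA : A.right.IsContinuous) (hB : B.left.IsContinuous) :
    LocallyCompactSpace (FibreProd A B) :=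
  (isClosed_range hA hB).isClosedEmbedding_subtypeVal.locallyCompactSpace

theorem continuous_mk {T : Type*} [TopologicalSpace T] {f : T → FibreProd A B}
    (h₁ : Continuous fun t => (f t).fst) (h₂ : Continuous fun t => (f t).snd) : Continuous f :=
  continuous_induced_rng.2 (h₁.prodMk h₂)

theorem diagAction_isContinuous (hA : A.right.IsContinuous) (hB : B.left.IsContinuous) :
    (diagAction A B).IsContinuous where
  mom := hA.mom.comp continuous_fst'
  act := by
    refine continuous_mk ?_ ?_
    · refine (hA.act.comp (f := fun p : (diagAction A B).Trans =>
        (⟨(p.1.1.fst, p.1.2), p.2⟩ : A.right.Trans)) ?_)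
      exact Continuous.subtype_mk ((continuous_fst'.comp (by fun_prop)).prodMk (by fun_prop)) _
    · refine (hB.act.comp (f := fun p : (diagAction A B).Trans =>
        (⟨(𝓖₂.inv p.1.2, p.1.1.snd), p.1.1.s_inv_eq p.1.2 p.2⟩ : B.left.Trans)) ?_)
      exact Continuous.subtype_mk ((𝓖₂.continuous_inv.comp (by fun_prop)).prodMk
        (continuous_snd'.comp (by fun_prop))) _

theorem leftAction_isContinuous (hA : A.left.IsContinuous) :
    (leftAction A B).IsContinuous where
  mom := hA.mom.comp continuous_fst'
  act := by
    have h : Continuous fun p : (leftAction A B).Trans => p.1.2.snd :=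
      continuous_snd'.comp (continuous_snd.comp continuous_subtype_val)
    refine continuous_mk ?_ h
    refine (hA.act.comp (f := fun p : (leftAction A B).Trans =>
        (⟨(p.1.1, p.1.2.fst), p.2⟩ : A.left.Trans)) ?_)
    exact Continuous.subtype_mk (Continuous.prodMk (by fun_prop)
      (continuous_fst'.comp (by fun_prop))) _

theorem rightAction_isContinuous (hB : B.right.IsContinuous) :
    (rightAction A B).IsContinuous where
  mom := hB.mom.comp continuous_snd'
  act := by
    have h : Continuous fun p : (rightAction A B).Trans => p.1.1.fst :=
      continuous_fst'.comp (continuous_fst.comp continuous_subtype_val)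
    refine continuous_mk h ?_
    refine (hB.act.comp (f := fun p : (rightAction A B).Trans =>
        (⟨(p.1.1.snd, p.1.2), p.2⟩ : B.right.Trans)) ?_)
    exact Continuous.subtype_mk ((continuous_snd'.comp (by fun_prop)).prodMk (by fun_prop)) _

/-- First coordinates alone already confine the acting element, by properness of the action on `X`.
-/
theorem diagAction_isProper [T2Space X] [T2Space Y] [T2Space U₂] [LocallyCompactSpace X]
    [LocallyCompactSpace Y] (hA : A.right.IsContinuous) (hB : B.left.IsContinuous)
    (hP : A.right.IsProper) : (diagAction A B).IsProper := by
  have := locallyCompactSpace hA hB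
  refine RightAction.isProper_of_exists_isCompact (diagAction_isContinuous hA hB)
    fun C₁ C₂ h₁ h₂ => ?_
  obtain ⟨L, hL, hL'⟩ := hP.exists_isCompact (h₁.image continuous_fst')
    (h₂.image continuous_fst')
  exact ⟨L, hL, fun z g h hz hzg => hL' z.fst g h ⟨z, hz, rfl⟩ ⟨_, hzg, rfl⟩⟩

end FibreProd

namespace OrbitSpace

open FibreProd

variable {A B} [TopologicalSpace X] [TopologicalSpace Y]

theorem isQuotientMap_proj : IsQuotientMap (proj : FibreProd A B → OrbitSpace A B) :=
  isQuotientMap_quot_mk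

theorem isOrbitMap_proj (hr : IsOpenMap 𝓖₂.r) (hA : A.right.IsContinuous)
    (hB : B.left.IsContinuous) :
    (diagAction A B).IsOrbitMap (proj : FibreProd A B → OrbitSpace A B) where
  isOpenQuotientMap := ⟨proj_surjective, isQuotientMap_proj.continuous,
    RightAction.isOpenMap_of_isQuotientMap hr (diagAction_isContinuous hA hB) isQuotientMap_proj
      fun _ _ => proj_eq_iff⟩
  eq_iff _ _ := proj_eq_iff

theorem continuous_leftMom (hA : A.left.IsContinuous) :
    Continuous (leftMom : OrbitSpace A B → U₁) :=
  isQuotientMap_proj.continuous_iff.2 (hA.mom.comp continuous_fst')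

theorem continuous_rightMom (hB : B.right.IsContinuous) :
    Continuous (rightMom : OrbitSpace A B → U₃) :=
  isQuotientMap_proj.continuous_iff.2 (hB.mom.comp continuous_snd')

theorem continuousOn_leftActAux (hπ : IsOpenQuotientMap (proj : FibreProd A B → OrbitSpace A B))
    (hA : A.left.IsContinuous) :
    ContinuousOn (fun a : G₁ × OrbitSpace A B => leftActAux a.1 a.2)
      {a | 𝓖₁.s a.1 = leftMom a.2} := by
  refine (IsOpenQuotientMap.prodMap .id hπ).continuousOn_of_comp ?_
  simp only [Prod.map_fst, Prod.map_snd, id, ← proj_leftAction_tact]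
  exact hπ.continuous.comp_continuousOn (leftAction_isContinuous hA).continuousOn_tact

theorem continuousOn_rightActAux (hπ : IsOpenQuotientMap (proj : FibreProd A B → OrbitSpace A B))
    (hB : B.right.IsContinuous) :
    ContinuousOn (fun a : OrbitSpace A B × G₃ => rightActAux a.1 a.2)
      {a | rightMom a.1 = 𝓖₃.r a.2} := by
  refine (IsOpenQuotientMap.prodMap hπ .id).continuousOn_of_comp ?_
  simp only [Prod.map_fst, Prod.map_snd, id, ← proj_rightAction_tact]
  exact hπ.continuous.comp_continuousOn (rightAction_isContinuous hB).continuousOn_tact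

theorem bispace_left_isContinuous
    (hπ : IsOpenQuotientMap (proj : FibreProd A B → OrbitSpace A B))
    (hA : A.left.IsContinuous) : (bispace A B).left.IsContinuous where
  mom := continuous_leftMom hA
  act := (continuousOn_leftActAux hπ hA).domRestrict

theorem bispace_right_isContinuous
    (hπ : IsOpenQuotientMap (proj : FibreProd A B → OrbitSpace A B))
    (hB : B.right.IsContinuous) : (bispace A B).right.IsContinuous where
  mom := continuous_rightMom hB
  act := (continuousOn_rightActAux hπ hB).domRestrict

/-- Lift the two compact sets to compact `C₁`, `C₂` in Z. If [x, y]c lies in the second set, then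
(xg, g⁻¹(yc)) lies in `C₂` for some g. Properness on `X` confines g, so yc = g(g⁻¹(yc)) lies in a
compact set, and properness on `Y` confines c. -/
theorem bispace_right_isProper [T2Space X] [T2Space Y] [LocallyCompactSpace X]
    [LocallyCompactSpace Y] [T2Space U₂] [T2Space U₃] (hr : IsOpenMap 𝓖₂.r)
    (hA : A.right.IsContinuous) (hB : B.left.IsContinuous) (hB' : B.right.IsContinuous)
    (hP : A.right.IsProper) (hP' : B.right.IsProper) : (bispace A B).right.IsProper := by
  have := locallyCompactSpace hA hB
  have hπ := isOrbitMap_proj hr hA hB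
  have := hπ.t2Space (diagAction_isProper hA hB hP)
  have := hπ.isOpenQuotientMap.locallyCompactSpace
  refine RightAction.isProper_of_exists_isCompact
    (bispace_right_isContinuous hπ.isOpenQuotientMap hB') fun K₁ K₂ h₁ h₂ => ?_
  obtain ⟨C₁, hC₁, hK₁⟩ := hπ.exists_isCompact_lift h₁
  obtain ⟨C₂, hC₂, hK₂⟩ := hπ.exists_isCompact_lift h₂
  obtain ⟨L₂, hL₂, hL₂'⟩ := hP.exists_isCompact (hC₁.image continuous_fst')
    (hC₂.image continuous_fst')
  have hcl : IsClosed {a : G₂ × Y | 𝓖₂.s a.1 = B.left.mom a.2} :=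
    isClosed_eq (𝓖₂.continuous_s.comp continuous_fst) (hB.mom.comp continuous_snd)
  have hM : IsCompact ((fun a : G₂ × Y => B.left.tact a.1 a.2) ''
      ((L₂ ×ˢ (snd '' C₂)) ∩ {a : G₂ × Y | 𝓖₂.s a.1 = B.left.mom a.2})) :=
    ((hL₂.prod (hC₂.image continuous_snd')).inter_right hcl).image_of_continuousOn
      (hB.continuousOn_tact.mono Set.inter_subset_right)
  obtain ⟨L₃, hL₃, hL₃'⟩ := hP'.exists_isCompact (hC₁.image continuous_snd') hM
  refine ⟨L₃, hL₃, fun ω c h hω hωc => ?_⟩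
  obtain ⟨z, hz, rfl⟩ := hK₁ hω
  obtain ⟨w, hw, hwz⟩ := hK₂ hωc
  change B.right.mom z.snd = 𝓖₃.r c at h
  change proj w = rightActAux (proj z) c at hwz
  rw [rightActAux_proj z c h] at hwz
  obtain ⟨g, hg, rfl⟩ := proj_eq_iff.1 hwz.symm
  refine hL₃' z.snd c h ⟨z, hz, rfl⟩ ?_
  have hg2 : g ∈ L₂ := hL₂' z.fst g hg ⟨z, hz, rfl⟩ ⟨_, hw, rfl⟩
  have hcomp : 𝓖₂.s g = B.left.mom ((rightAct z c h).diag g hg).snd :=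
    ((B.left.mom_act _ _ _).trans (𝓖₂.r_inv g)).symm
  refine ⟨(g, ((rightAct z c h).diag g hg).snd), ⟨⟨hg2, _, hw, rfl⟩, hcomp⟩, ?_⟩
  refine (B.left.tact_eq hcomp).trans ?_
  have := B.left.mul_act g (𝓖₂.inv g) (rightAct z c h).snd (𝓖₂.r_inv g).symm
    ((rightAct z c h).s_inv_eq g hg)
  rw [B.left.act_of_eq_one (𝓖₂.mul_inv g)] at this
  exact this.symm

end OrbitSpace

end Composite

/-! ### Measures on the composite -/

section CompositeMeasures

open FibreProd OrbitSpace

variable {G₁ U₁ G₂ U₂ G₃ U₃ X Y : Type*}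
  [TopologicalSpace G₁] [TopologicalSpace U₁] [TopologicalSpace G₂] [TopologicalSpace U₂]
  [TopologicalSpace G₃] [TopologicalSpace U₃] [TopologicalSpace X] [TopologicalSpace Y]
  [MeasurableSpace G₁] [MeasurableSpace G₂] [MeasurableSpace G₃]
  [MeasurableSpace X] [MeasurableSpace Y]
  {𝓖₁ : HaarGroupoid G₁ U₁} {𝓖₂ : HaarGroupoid G₂ U₂} {𝓖₃ : HaarGroupoid G₃ U₃}
  {𝒳 : TopologicalCorrespondence 𝓖₁ 𝓖₂ X} {𝒴 : TopologicalCorrespondence 𝓖₂ 𝓖₃ Y}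

open Classical in
/-- The extension by zero of a function on the fibre product. -/
def fibExt (F : FibreProd 𝒳.toBispace 𝒴.toBispace → ℝ) (x : X) (y : Y) : ℝ :=
  if h : 𝒳.right.mom x = 𝒴.left.mom y then F ⟨(x, y), h⟩ else 0

theorem fibExt_eq (F : FibreProd 𝒳.toBispace 𝒴.toBispace → ℝ) {x : X} {y : Y}
    (h : 𝒳.right.mom x = 𝒴.left.mom y) : fibExt F x y = F ⟨(x, y), h⟩ := dif_pos h

theorem continuousOn_fibExt {F : FibreProd 𝒳.toBispace 𝒴.toBispace → ℝ} (hF : Continuous F) :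
    ContinuousOn (fun a : X × Y => fibExt F a.1 a.2)
      {a | 𝒳.right.mom a.1 = 𝒴.left.mom a.2} := by
  rw [continuousOn_iff_continuous_domRestrict]
  exact hF.congr fun a => (fibExt_eq F a.2).symm

theorem fibreProdIntegral_eq (u : U₃) (F : FibreProd 𝒳.toBispace 𝒴.toBispace → ℝ) :
    fibreProdIntegral 𝒳 𝒴 u F =
      ∫ y, ∫ x, fibExt F x y ∂𝒳.lam (𝒴.left.mom y) ∂𝒴.lam u := rfl

theorem orbitIntegral_eq (F : FibreProd 𝒳.toBispace 𝒴.toBispace → ℝ)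
    (ω : OrbitSpace 𝒳.toBispace 𝒴.toBispace) :
    orbitIntegral 𝒳 𝒴 F ω = orbInt 𝓖₂ (diagAction 𝒳.toBispace 𝒴.toBispace) F ω.rep := by
  refine 𝓖₂.haar_family.integral_congr fun g hg => ?_
  rw [dif_pos hg.symm, (diagAction 𝒳.toBispace 𝒴.toBispace).tact_eq hg.symm]
  rfl

theorem IsCompositeCochain.diag_eq {b : FibreProd 𝒳.toBispace 𝒴.toBispace → ℝ}
    (hb : IsCompositeCochain 𝒳 𝒴 b) (z : FibreProd 𝒳.toBispace 𝒴.toBispace) (g : G₂)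
    (h : z.mom = 𝓖₂.r g) :
    b (z.diag g h) = 𝒴.adj ⟨(𝓖₂.inv g, z.snd), z.s_inv_eq g h⟩ * b z := by
  rw [← hb.coboundary z g h, div_mul_cancel₀ _ (ne_of_gt (hb.pos z))]

/-- Two cochains with the same coboundary differ by a function on the orbit space. -/
theorem IsCompositeCochain.div_eq_of_proj_eq {b b' : FibreProd 𝒳.toBispace 𝒴.toBispace → ℝ}
    (hb : IsCompositeCochain 𝒳 𝒴 b) (hb' : IsCompositeCochain 𝒳 𝒴 b')
    {z w : FibreProd 𝒳.toBispace 𝒴.toBispace} (h : proj z = proj w) :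
    b' z / b z = b' w / b w := by
  obtain ⟨g, hg, rfl⟩ := proj_eq_iff.1 h
  -- Moving along the orbit multiplies both cochains by the same value of Δ₂, which cancels.
  rw [hb.diag_eq, hb'.diag_eq, mul_div_mul_left _ _ (𝒴.adjoining.pos _).ne']

variable {b : FibreProd 𝒳.toBispace 𝒴.toBispace → ℝ}
  {μ : U₃ → Measure (OrbitSpace 𝒳.toBispace 𝒴.toBispace)}
  {φ : FibreProd 𝒳.toBispace 𝒴.toBispace → ℝ}

theorem IsCutoff.orbInt_mul_comp (hφ : IsCutoff 𝓖₂ (diagAction 𝒳.toBispace 𝒴.toBispace) proj φ)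
    (hπ : (diagAction 𝒳.toBispace 𝒴.toBispace).IsOrbitMap proj)
    (f : OrbitSpace 𝒳.toBispace 𝒴.toBispace → ℝ)
    (z : FibreProd 𝒳.toBispace 𝒴.toBispace) :
    orbInt 𝓖₂ (diagAction 𝒳.toBispace 𝒴.toBispace) (fun w => φ w * f (proj w)) z =
      f (proj z) := by
  rw [_root_.orbInt_mul_comp hπ, hφ.orbInt_eq_one, one_mul]

variable [T2Space X] [T2Space Y]

theorem IsCutoff.hasCompactSupport_mul
    (hφ : IsCutoff 𝓖₂ (diagAction 𝒳.toBispace 𝒴.toBispace) proj φ)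
    {f : OrbitSpace 𝒳.toBispace 𝒴.toBispace → ℝ} (hf : HasCompactSupport f) :
    HasCompactSupport fun z => φ z * f (proj z) := by
  obtain ⟨C, hC, hC'⟩ := hφ.hasFibrewiseCompactSupport _ hf
  refine HasCompactSupport.of_support_subset_isCompact hC fun z hz => ?_
  exact hC' z (subset_tsupport _ (right_ne_zero_of_mul hz)) (left_ne_zero_of_mul hz)

/-- The lift of a compactly supported function on the orbit space along a cutoff function. -/
def IsCutoff.lift (hφ : IsCutoff 𝓖₂ (diagAction 𝒳.toBispace 𝒴.toBispace) proj φ)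
    (f : C_c(OrbitSpace 𝒳.toBispace 𝒴.toBispace, ℝ)) :
    C_c(FibreProd 𝒳.toBispace 𝒴.toBispace, ℝ) :=
  ⟨⟨fun z => φ z * f (proj z),
    hφ.continuous.mul (f.continuous.comp isQuotientMap_proj.continuous)⟩,
    hφ.hasCompactSupport_mul f.hasCompactSupport⟩

theorem IsComposite.continuous_mul (hμ : IsComposite 𝒳 𝒴 b μ)
    (hφ : IsCutoff 𝓖₂ (diagAction 𝒳.toBispace 𝒴.toBispace) proj φ)
    (f : C_c(OrbitSpace 𝒳.toBispace 𝒴.toBispace, ℝ)) :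
    Continuous (fun z => φ z * f (proj z) * b z) ∧
      HasCompactSupport fun z => φ z * f (proj z) * b z :=
  ⟨(hφ.lift f).continuous.mul hμ.cochain.continuous, (hφ.lift f).hasCompactSupport.mul_right⟩

/-- Since `f` is the orbit integral of φ·(f ∘ π), the lifting property evaluates its integral on Z.
All later properties of `μ` on Ω rest on this formula. -/
theorem IsComposite.integral_eq (hμ : IsComposite 𝒳 𝒴 b μ)
    (hφ : IsCutoff 𝓖₂ (diagAction 𝒳.toBispace 𝒴.toBispace) proj φ)
    (hπ : (diagAction 𝒳.toBispace 𝒴.toBispace).IsOrbitMap proj)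
    (f : C_c(OrbitSpace 𝒳.toBispace 𝒴.toBispace, ℝ)) (u : U₃) :
    ∫ ω, f ω ∂μ u = fibreProdIntegral 𝒳 𝒴 u fun z => φ z * f (proj z) * b z := by
  refine Eq.trans ?_ (hμ.lift u (hφ.lift f))
  congr 1
  funext ω
  rw [orbitIntegral_eq]
  refine Eq.trans ?_ (hφ.orbInt_mul_comp hπ f _).symm
  rw [proj_rep]

/-- By inner regularity, test functions supported off the fibre suffice. Their lifts vanish on the
part of Z over the fibre of `Y` that carries β_u. -/
theorem IsComposite.concentrated [T2Space U₃] [T2Space (OrbitSpace 𝒳.toBispace 𝒴.toBispace)]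
    [LocallyCompactSpace (OrbitSpace 𝒳.toBispace 𝒴.toBispace)] (hμ : IsComposite 𝒳 𝒴 b μ)
    (hφ : IsCutoff 𝓖₂ (diagAction 𝒳.toBispace 𝒴.toBispace) proj φ)
    (hπ : (diagAction 𝒳.toBispace 𝒴.toBispace).IsOrbitMap proj) (u : U₃) :
    μ u (rightMom ⁻¹' {u})ᶜ = 0 := by
  have := hμ.regular u
  have hV : IsOpen (rightMom ⁻¹' {u} : Set (OrbitSpace 𝒳.toBispace 𝒴.toBispace))ᶜ :=
    (isClosed_singleton.preimage (continuous_rightMom 𝒴.right_continuous)).isOpen_compl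
  rw [hV.measure_eq_iSup_isCompact]
  simp only [ENNReal.iSup_eq_zero]
  intro K hKV hK
  obtain ⟨f, f1, f0, -, fV⟩ := exists_compactlySupported_eq_one hK hV hKV
  have h0 : ∫ ω, f ω ∂μ u = 0 := by
    rw [hμ.integral_eq hφ hπ]
    refine 𝒴.family.integral_eq_zero fun y hy => 𝒳.family.integral_eq_zero fun x hx => ?_
    rw [dif_pos hx]
    have : f (proj ⟨(x, y), hx⟩) = 0 := by
      by_contra h
      exact fV _ h hy
    change φ _ * f (proj ⟨(x, y), hx⟩) * b _ = 0
    rw [this, mul_zero, zero_mul]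
  have h1 : ∀ᵐ ω ∂μ u, f ω = 0 := (integral_eq_zero_iff_of_nonneg f0 f.integrable).1 h0
  refine measure_mono_null (fun ω hω => ?_) h1
  change ¬ f ω = 0
  rw [f1 ω hω]; exact one_ne_zero

/-- Substituting b' = (c ∘ π) b in the integral formula for μ' gives the formula for μ with `f c` in
place of `f`. Continuity and positivity of `c` follow from c ∘ π = b'/b. -/
theorem IsComposite.isRNDeriv [T2Space (OrbitSpace 𝒳.toBispace 𝒴.toBispace)]
    [LocallyCompactSpace (OrbitSpace 𝒳.toBispace 𝒴.toBispace)]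
    {b' : FibreProd 𝒳.toBispace 𝒴.toBispace → ℝ}
    {μ' : U₃ → Measure (OrbitSpace 𝒳.toBispace 𝒴.toBispace)}
    (hμ : IsComposite 𝒳 𝒴 b μ) (hμ' : IsComposite 𝒳 𝒴 b' μ')
    (hφ : IsCutoff 𝓖₂ (diagAction 𝒳.toBispace 𝒴.toBispace) proj φ)
    (hπ : (diagAction 𝒳.toBispace 𝒴.toBispace).IsOrbitMap proj)
    {c : OrbitSpace 𝒳.toBispace 𝒴.toBispace → ℝ} (hc : ∀ z, b' z = c (proj z) * b z) :
    Continuous c ∧ (∀ ω, 0 < c ω) ∧ IsRNDeriv μ' μ c := by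
  have hc' : ∀ z, c (proj z) = b' z / b z := fun z => by
    rw [hc, mul_div_cancel_right₀ _ (hμ.cochain.pos z).ne']
  have hcc : Continuous c := by
    rw [isQuotientMap_proj.continuous_iff]
    exact (hμ'.cochain.continuous.div hμ.cochain.continuous
      fun z => (hμ.cochain.pos z).ne').congr fun z => (hc' z).symm
  have hpos : ∀ ω, 0 < c ω := fun ω => by
    obtain ⟨z, rfl⟩ := proj_surjective ω
    rw [hc']
    exact div_pos (hμ'.cochain.pos z) (hμ.cochain.pos z)
  refine ⟨hcc, hpos, fun u => ?_⟩
  have := hμ.regular u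
  have := hμ'.regular u
  refine eq_withDensity_of_integral_eq hcc hpos fun f => ?_
  rw [hμ'.integral_eq hφ hπ]
  have := hμ.integral_eq hφ hπ
    ⟨⟨fun ω => f ω * c ω, f.continuous.mul hcc⟩, f.hasCompactSupport.mul_right⟩ u
  refine Eq.trans ?_ this.symm
  congr 1
  funext z
  change _ = φ z * (f (proj z) * c (proj z)) * b z
  rw [hc z]
  ring

variable [BorelSpace X] [LocallyCompactSpace X] [T2Space U₂]

/-- Integration over the first factor of the fibre product. -/
theorem exists_fst_integral {F : FibreProd 𝒳.toBispace 𝒴.toBispace → ℝ} (hF : Continuous F)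
    (hF' : HasCompactSupport F) :
    ∃ k : C_c(Y, ℝ), ∀ y, k y = ∫ x, fibExt F x y ∂𝒳.lam (𝒴.left.mom y) := by
  have hsupp : ∀ x y, 𝒳.right.mom x = 𝒴.left.mom y → fibExt F x y ≠ 0 →
      x ∈ fst '' tsupport F ∧ y ∈ snd '' tsupport F := fun x y h h0 => by
    rw [fibExt_eq F h] at h0
    exact ⟨⟨_, subset_tsupport _ h0, rfl⟩, ⟨_, subset_tsupport _ h0, rfl⟩⟩
  refine ⟨⟨⟨fun y => ∫ x, fibExt F x y ∂𝒳.lam (𝒴.left.mom y), ?_⟩, ?_⟩, fun y => rfl⟩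
  · refine 𝒳.family.continuous_fibre_integral 𝒳.right_continuous.mom 𝒴.left_continuous.mom
      (F := fun y x => fibExt F x y) ?_ fun y => ⟨Set.univ, Filter.univ_mem, fst '' tsupport F,
        IsCompact.image hF' continuous_fst', fun y _ x h h0 => (hsupp x y h h0).1⟩
    exact (continuousOn_fibExt hF).comp
      (by fun_prop : ContinuousOn (fun a : Y × X => (a.2, a.1)) _) fun a ha => ha
  · refine HasCompactSupport.of_support_subset_isCompact (IsCompact.image hF' continuous_snd')
      fun y hy => ?_
    by_contra hcon
    refine hy (𝒳.family.integral_eq_zero fun x hx => ?_)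
    by_contra h0
    exact hcon (hsupp x y hx h0).2

theorem IsComposite.continuous_integral (hμ : IsComposite 𝒳 𝒴 b μ)
    (hφ : IsCutoff 𝓖₂ (diagAction 𝒳.toBispace 𝒴.toBispace) proj φ)
    (hπ : (diagAction 𝒳.toBispace 𝒴.toBispace).IsOrbitMap proj)
    (f : C_c(OrbitSpace 𝒳.toBispace 𝒴.toBispace, ℝ)) :
    Continuous fun u => ∫ ω, f ω ∂μ u := by
  obtain ⟨k, hk⟩ := exists_fst_integral (hμ.continuous_mul hφ f).1 (hμ.continuous_mul hφ f).2
  simp only [hμ.integral_eq hφ hπ f, fibreProdIntegral_eq, ← hk]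
  exact 𝒴.family.continuous_integral k

theorem IsComposite.isContinuousFamily [T2Space U₃] [T2Space (OrbitSpace 𝒳.toBispace 𝒴.toBispace)]
    [LocallyCompactSpace (OrbitSpace 𝒳.toBispace 𝒴.toBispace)] (hμ : IsComposite 𝒳 𝒴 b μ)
    (hφ : IsCutoff 𝓖₂ (diagAction 𝒳.toBispace 𝒴.toBispace) proj φ)
    (hπ : (diagAction 𝒳.toBispace 𝒴.toBispace).IsOrbitMap proj) :
    IsContinuousFamily rightMom μ where
  regular := hμ.regular
  concentrated := hμ.concentrated hφ hπ
  continuous_integral := hμ.continuous_integral hφ hπ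

/-- Translation by an element of `G₃` lifts to Z, where it moves only the `Y` coordinate, commutes
with `G₂` and preserves b. Invariance of β, applied to the integral of φ (f ∘ π) b over the `X`
fibres, finishes the argument. Since φ need not be `G₃`-invariant, the lift is translated as a
whole. -/
theorem IsComposite.isInvariantFamily [T2Space U₃] [T2Space (OrbitSpace 𝒳.toBispace 𝒴.toBispace)]
    [LocallyCompactSpace (OrbitSpace 𝒳.toBispace 𝒴.toBispace)]
    [LocallyCompactSpace (FibreProd 𝒳.toBispace 𝒴.toBispace)] (hμ : IsComposite 𝒳 𝒴 b μ)
    (hφ : IsCutoff 𝓖₂ (diagAction 𝒳.toBispace 𝒴.toBispace) proj φ)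
    (hπ : (diagAction 𝒳.toBispace 𝒴.toBispace).IsOrbitMap proj) :
    (bispace 𝒳.toBispace 𝒴.toBispace).right.IsInvariantFamily μ := by
  intro c f
  set R := rightAction 𝒳.toBispace 𝒴.toBispace
  have hR : R.IsContinuous := rightAction_isContinuous 𝒴.right_continuous
  let Φ := hφ.lift f
  let S : Set (FibreProd 𝒳.toBispace 𝒴.toBispace) := R.mom ⁻¹' {𝓖₃.r c}
  have hS : IsClosed S := isClosed_singleton.preimage hR.mom
  have hmove : ∀ e : G₃, ContinuousOn (fun z => R.tact z e) (R.mom ⁻¹' {𝓖₃.r e}) := fun e =>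
    hR.continuousOn_tact.comp (by fun_prop : ContinuousOn (fun z => (z, e)) _) fun z hz => hz
  have hinv : ∀ z ∈ S, R.mom (R.tact z c) = 𝓖₃.r (𝓖₃.inv c) ∧
      R.tact (R.tact z c) (𝓖₃.inv c) = z := fun z hz => by
    have h1 : R.mom z = 𝓖₃.r c := hz
    have h2 : R.mom (R.act z c h1) = 𝓖₃.r (𝓖₃.inv c) := (R.mom_act _ _ _).trans (𝓖₃.r_inv c).symm
    rw [R.tact_eq h1]
    refine ⟨h2, ?_⟩
    rw [R.tact_act h1 (𝓖₃.r_inv c).symm, R.tact_eq (h1.trans (𝓖₃.r_mul _ _ _).symm),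
      R.act_of_eq_one (𝓖₃.mul_inv c)]
  -- `Ψ` extends z ↦ Φ(zc) from the fibre where zc is defined; its support there lies in the
  -- translate of the support of `Φ` by c⁻¹.
  obtain ⟨Ψ, hΨ⟩ := exists_compactlySupported_eqOn hS
    (K := (fun z => R.tact z (𝓖₃.inv c)) '' (tsupport Φ ∩ R.mom ⁻¹' {𝓖₃.r (𝓖₃.inv c)}))
    ((Φ.hasCompactSupport.isCompact.inter_right
      (isClosed_singleton.preimage hR.mom)).image_of_continuousOn
      ((hmove (𝓖₃.inv c)).mono Set.inter_subset_right))
    (f := fun z => Φ (R.tact z c)) (Φ.continuous.comp_continuousOn (hmove c))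
    (fun z hz h0 => ⟨_, ⟨subset_tsupport _ h0, (hinv z hz).1⟩, (hinv z hz).2⟩)
  have hfam := hμ.isContinuousFamily hφ hπ
  have hL : ∀ ω : OrbitSpace 𝒳.toBispace 𝒴.toBispace, rightMom ω = 𝓖₃.r c →
      f (rightActAux ω c) = orbitIntegral 𝒳 𝒴 Ψ ω := by
    intro ω hω
    rw [orbitIntegral_eq]
    have hz : (𝒴.right.mom ω.rep.snd) = 𝓖₃.r c := by
      rw [← proj_rep ω] at hω; exact hω
    -- The cutoff is normalised along every orbit, in particular along that of the translated
    -- representative.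
    have h1 := hφ.orbInt_mul_comp hπ f (ω.rep.rightAct c hz)
    rw [← rightActAux_proj _ c hz, proj_rep] at h1
    rw [← h1]
    refine 𝓖₂.haar_family.integral_congr fun g hg => ?_
    have hg' : ω.rep.mom = 𝓖₂.r g := hg.symm
    have hm : 𝒴.right.mom (ω.rep.diag g hg').snd = 𝓖₃.r c := (𝒴.right_mom_act _ _ _).trans hz
    rw [(diagAction 𝒳.toBispace 𝒴.toBispace).tact_eq hg',
      (diagAction 𝒳.toBispace 𝒴.toBispace).tact_eq (x := ω.rep.rightAct c hz) hg']
    refine Eq.trans ?_ (hΨ (ω.rep.diag g hg') hm).symm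
    change Φ ((ω.rep.rightAct c hz).diag g hg') = Φ (R.tact (ω.rep.diag g hg') c)
    rw [diag_rightAct ω.rep g c hg' hz, R.tact_eq hm]
    rfl
  have hleft : ∫ ω, (open Classical in
      if h : (bispace 𝒳.toBispace 𝒴.toBispace).right.mom ω = 𝓖₃.r c then
        f ((bispace 𝒳.toBispace 𝒴.toBispace).right.act ω c h) else 0) ∂μ (𝓖₃.r c) =
      fibreProdIntegral 𝒳 𝒴 (𝓖₃.r c) fun z => Ψ z * b z := by
    rw [← hμ.lift]
    refine hfam.integral_congr fun ω hω => ?_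
    exact (dif_pos hω).trans (hL ω hω)
  obtain ⟨k, hk⟩ := exists_fst_integral (hμ.continuous_mul hφ f).1 (hμ.continuous_mul hφ f).2
  rw [hleft, hμ.integral_eq hφ hπ, fibreProdIntegral_eq, fibreProdIntegral_eq]
  simp only [← hk]
  rw [← 𝒴.invariant c k]
  refine 𝒴.family.integral_congr fun y hy => ?_
  rw [dif_pos hy, hk, 𝒴.left_mom_act]
  refine 𝒳.family.integral_congr fun x hx => ?_
  have hx' : 𝒳.right.mom x = 𝒴.left.mom (𝒴.right.act y c hy) :=
    hx.trans (𝒴.left_mom_act _ _ _).symm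
  rw [fibExt_eq _ hx, fibExt_eq _ hx', hΨ ⟨(x, y), hx⟩ hy, R.tact_eq (x := ⟨(x, y), hx⟩) hy]
  have := hμ.cochain.invariant ⟨(x, y), hx⟩ c hy
  rw [← this]
  rfl

end CompositeMeasures

/-! ### Integrals over translates by a left action -/

section Translation

variable {G U Z : Type*} [TopologicalSpace G] [TopologicalSpace U] [TopologicalSpace Z]

theorem LeftAction.IsContinuous.continuousOn_tact_inv {𝓖 : TopGroupoid G U} {L : LeftAction 𝓖 Z}
    (hL : L.IsContinuous) :
    ContinuousOn (fun a : Z × G => L.tact (𝓖.inv a.2) a.1) {a | 𝓖.r a.2 = L.mom a.1} :=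
  hL.continuousOn_tact.comp (f := fun a : Z × G => (𝓖.inv a.2, a.1))
    ((𝓖.continuous_inv.comp continuous_snd).prodMk continuous_fst).continuousOn
    fun a ha => (𝓖.s_inv a.2).trans ha

theorem LeftAction.IsContinuous.continuousOn_translate {𝓖 : TopGroupoid G U} {L : LeftAction 𝓖 Z}
    (hL : L.IsContinuous) {E : G → Z → ℝ}
    (hE : ContinuousOn (fun a : G × Z => E a.1 a.2) {a | 𝓖.s a.1 = L.mom a.2}) :
    ContinuousOn (fun a : Z × G => E a.2 (L.tact (𝓖.inv a.2) a.1)) {a | 𝓖.r a.2 = L.mom a.1} :=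
  hE.comp (f := fun a : Z × G => (a.2, L.tact (𝓖.inv a.2) a.1))
    (continuous_snd.continuousOn.prodMk hL.continuousOn_tact_inv)
    fun _ ha => L.mom_tact_inv ha

theorem LeftAction.IsContinuous.exists_isCompact_translate [T2Space U] {𝓖 : TopGroupoid G U}
    {L : LeftAction 𝓖 Z} (hL : L.IsContinuous) {K : Set G} {C : Set Z} (hK : IsCompact K)
    (hC : IsCompact C) :
    ∃ M : Set Z, IsCompact M ∧
      ∀ g z, 𝓖.r g = L.mom z → g ∈ K → L.tact (𝓖.inv g) z ∈ C → z ∈ M := by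
  have hcl : IsClosed {a : G × Z | 𝓖.s a.1 = L.mom a.2} :=
    isClosed_eq (𝓖.continuous_s.comp continuous_fst) (hL.mom.comp continuous_snd)
  refine ⟨_, ((hK.prod hC).inter_right hcl).image_of_continuousOn
    (hL.continuousOn_tact.mono Set.inter_subset_right), fun g z h hg hz => ?_⟩
  exact ⟨(g, L.tact (𝓖.inv g) z), ⟨⟨hg, hz⟩, L.mom_tact_inv h⟩, L.tact_tact_inv h⟩

/-- The support is compact because z = g(g⁻¹z) with g in `K` and g⁻¹z in `C`. The resulting function
can be inserted in the lifting property of a composite. -/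
theorem LeftAction.IsContinuous.exists_translate_integral [T2Space U] [T2Space G]
    [LocallyCompactSpace G] [MeasurableSpace G] [BorelSpace G] [T2Space Z] {𝓖 : HaarGroupoid G U}
    {L : LeftAction 𝓖.toTopGroupoid Z} (hL : L.IsContinuous) {E : G → Z → ℝ}
    (hE : ContinuousOn (fun a : G × Z => E a.1 a.2) {a | 𝓖.s a.1 = L.mom a.2})
    {K : Set G} {C : Set Z} (hK : IsCompact K) (hC : IsCompact C)
    (hEK : ∀ g z, 𝓖.s g = L.mom z → E g z ≠ 0 → g ∈ K ∧ z ∈ C) :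
    ∃ f : C_c(Z, ℝ), ∀ z, f z = ∫ g, E g (L.tact (𝓖.inv g) z) ∂𝓖.haar (L.mom z) := by
  obtain ⟨M, hM, hM'⟩ := hL.exists_isCompact_translate hK hC
  have hsupp : ∀ g z, 𝓖.r g = L.mom z → E g (L.tact (𝓖.inv g) z) ≠ 0 → g ∈ K ∧ z ∈ M :=
    fun g z h h0 => by
      obtain ⟨h1, h2⟩ := hEK _ _ (L.mom_tact_inv h) h0
      exact ⟨h1, hM' g z h h1 h2⟩
  refine ⟨⟨⟨fun z => ∫ g, E g (L.tact (𝓖.inv g) z) ∂𝓖.haar (L.mom z), ?_⟩, ?_⟩, fun _ => rfl⟩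
  · exact 𝓖.haar_family.continuous_fibre_integral 𝓖.continuous_r hL.mom
      (hL.continuousOn_translate hE) fun z₀ => ⟨Set.univ, Filter.univ_mem, K, hK,
        fun z _ g h h0 => (hsupp g z h h0).1⟩
  · refine HasCompactSupport.of_support_subset_isCompact hM fun z hz => ?_
    by_contra hcon
    refine hz (𝓖.haar_family.integral_eq_zero fun g hg => ?_)
    by_contra h0
    exact hcon (hsupp g z hg h0).2

end Translation

namespace FibreProd

variable {G₁ U₁ G₂ U₂ G₃ U₃ X Y : Type*}
  [TopologicalSpace G₁] [TopologicalSpace U₁] [TopologicalSpace G₂] [TopologicalSpace U₂]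
  [TopologicalSpace G₃] [TopologicalSpace U₃]
  {𝓖₁ : TopGroupoid G₁ U₁} {𝓖₂ : TopGroupoid G₂ U₂} {𝓖₃ : TopGroupoid G₃ U₃}
  {A : Bispace 𝓖₁ 𝓖₂ X} {B : Bispace 𝓖₂ 𝓖₃ Y}

theorem leftAction_mom_diagAction_tact (z : FibreProd A B) (g : G₂) :
    (leftAction A B).mom ((diagAction A B).tact z g) = (leftAction A B).mom z := by
  by_cases h : z.mom = 𝓖₂.r g
  · rw [(diagAction A B).tact_eq h]
    exact A.left_mom_act _ _ _
  · exact congrArg _ (dif_neg h)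

theorem diagAction_mom_leftAction_tact (a : G₁) (z : FibreProd A B) :
    (diagAction A B).mom ((leftAction A B).tact a z) = (diagAction A B).mom z := by
  by_cases h : 𝓖₁.s a = A.left.mom z.fst
  · rw [(leftAction A B).tact_eq h]
    exact A.right_mom_act _ _ _
  · exact congrArg _ (dif_neg h)

theorem leftAction_tact_diagAction_tact {a : G₁} {z : FibreProd A B} {g : G₂}
    (ha : 𝓖₁.s a = (leftAction A B).mom z) (h : (diagAction A B).mom z = 𝓖₂.r g) :
    (leftAction A B).tact a ((diagAction A B).tact z g) =
      (diagAction A B).tact ((leftAction A B).tact a z) g := by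
  rw [(leftAction A B).tact_eq (ha.trans (leftAction_mom_diagAction_tact z g).symm),
    (diagAction A B).tact_eq ((diagAction_mom_leftAction_tact a z).trans h),
    (leftAction A B).act_congr rfl ((diagAction A B).tact_eq h) _
      (ha.trans (A.left_mom_act _ _ h).symm),
    (diagAction A B).act_congr ((leftAction A B).tact_eq ha) rfl _
      ((A.right_mom_act _ _ ha).trans h)]
  exact (diag_leftAct a z g ha h).symm

theorem proj_diagAction_tact {z : FibreProd A B} {g : G₂} (h : (diagAction A B).mom z = 𝓖₂.r g) :
    OrbitSpace.proj ((diagAction A B).tact z g) = OrbitSpace.proj z := by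
  rw [(diagAction A B).tact_eq h]
  exact (OrbitSpace.proj_eq_iff.2 ⟨g, h, rfl⟩).symm

end FibreProd

/-! ### The adjoining function of the composite -/

section CompositeAdjoining

open FibreProd OrbitSpace

variable {G₁ U₁ G₂ U₂ G₃ U₃ X Y : Type*}
  [TopologicalSpace G₁] [TopologicalSpace U₁] [TopologicalSpace G₂] [TopologicalSpace U₂]
  [TopologicalSpace G₃] [TopologicalSpace U₃] [TopologicalSpace X] [TopologicalSpace Y]
  [MeasurableSpace G₁] [MeasurableSpace G₂] [MeasurableSpace G₃]
  [MeasurableSpace X] [MeasurableSpace Y]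
  {𝓖₁ : HaarGroupoid G₁ U₁} {𝓖₂ : HaarGroupoid G₂ U₂} {𝓖₃ : HaarGroupoid G₃ U₃}
  {𝒳 : TopologicalCorrespondence 𝓖₁ 𝓖₂ X} {𝒴 : TopologicalCorrespondence 𝓖₂ 𝓖₃ Y}

open Classical in
variable (𝒳) in
/-- The adjoining function of a correspondence, extended by zero. -/
def adjExt (g : G₁) (x : X) : ℝ :=
  if h : 𝓖₁.s g = 𝒳.left.mom x then 𝒳.adj ⟨(g, x), h⟩ else 0

theorem adjExt_eq {g : G₁} {x : X} (h : 𝓖₁.s g = 𝒳.left.mom x) :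
    adjExt 𝒳 g x = 𝒳.adj ⟨(g, x), h⟩ := dif_pos h

theorem continuousOn_adjExt :
    ContinuousOn (fun a : G₁ × X => adjExt 𝒳 a.1 a.2) {a | 𝓖₁.s a.1 = 𝒳.left.mom a.2} := by
  rw [continuousOn_iff_continuous_domRestrict]
  exact 𝒳.adjoining.continuous.congr fun a => (adjExt_eq a.2).symm

/-- The adjoining function of a composite before averaging over the orbits of the middle
groupoid: `Δ₁(g, x) b(x, y) / b(g x, y)`. -/
def compositeWeight (b : FibreProd 𝒳.toBispace 𝒴.toBispace → ℝ) (g : G₁)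
    (z : FibreProd 𝒳.toBispace 𝒴.toBispace) : ℝ :=
  adjExt 𝒳 g z.fst * (b z / b ((leftAction 𝒳.toBispace 𝒴.toBispace).tact g z))

/-- The adjoining function of a composite: the average of `compositeWeight` with respect to a
cutoff function. -/
def compositeAdj (b φ : FibreProd 𝒳.toBispace 𝒴.toBispace → ℝ) (g : G₁)
    (ω : OrbitSpace 𝒳.toBispace 𝒴.toBispace) : ℝ :=
  orbInt 𝓖₂ (diagAction 𝒳.toBispace 𝒴.toBispace) (fun z => compositeWeight b g z * φ z) ω.rep

variable {b φ : FibreProd 𝒳.toBispace 𝒴.toBispace → ℝ}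
  {μ : U₃ → Measure (OrbitSpace 𝒳.toBispace 𝒴.toBispace)}

theorem continuousOn_compositeWeight (hb : IsCompositeCochain 𝒳 𝒴 b) :
    ContinuousOn (fun a : G₁ × FibreProd 𝒳.toBispace 𝒴.toBispace => compositeWeight b a.1 a.2)
      {a | 𝓖₁.s a.1 = (leftAction 𝒳.toBispace 𝒴.toBispace).mom a.2} := by
  refine ContinuousOn.mul ?_ (ContinuousOn.div ?_ ?_ fun a _ => (hb.pos _).ne')
  · exact continuousOn_adjExt.comp
      (f := fun a : G₁ × FibreProd 𝒳.toBispace 𝒴.toBispace => (a.1, a.2.fst))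
      (continuous_fst.prodMk (continuous_fst'.comp continuous_snd)).continuousOn fun a ha => ha
  · exact (hb.continuous.comp continuous_snd).continuousOn
  · exact hb.continuous.comp_continuousOn
      (leftAction_isContinuous 𝒳.left_continuous).continuousOn_tact

theorem compositeWeight_pos (hb : IsCompositeCochain 𝒳 𝒴 b) {g : G₁}
    {z : FibreProd 𝒳.toBispace 𝒴.toBispace}
    (h : 𝓖₁.s g = (leftAction 𝒳.toBispace 𝒴.toBispace).mom z) : 0 < compositeWeight b g z := by
  rw [compositeWeight, adjExt_eq h]
  exact mul_pos (𝒳.adjoining.pos _) (div_pos (hb.pos _) (hb.pos _))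

theorem continuousOn_compositeWeight_orbit (hb : IsCompositeCochain 𝒳 𝒴 b) (hφ : Continuous φ) :
    ContinuousOn (fun a : (G₁ × FibreProd 𝒳.toBispace 𝒴.toBispace) × G₂ =>
        compositeWeight b a.1.1 ((diagAction 𝒳.toBispace 𝒴.toBispace).tact a.1.2 a.2) *
          φ ((diagAction 𝒳.toBispace 𝒴.toBispace).tact a.1.2 a.2))
      {a | 𝓖₁.s a.1.1 = (leftAction 𝒳.toBispace 𝒴.toBispace).mom a.1.2 ∧
        𝓖₂.r a.2 = (diagAction 𝒳.toBispace 𝒴.toBispace).mom a.1.2} := by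
  have hR := diagAction_isContinuous 𝒳.right_continuous 𝒴.left_continuous
  have h1 : ContinuousOn (fun a : (G₁ × FibreProd 𝒳.toBispace 𝒴.toBispace) × G₂ =>
      (diagAction 𝒳.toBispace 𝒴.toBispace).tact a.1.2 a.2)
      {a | 𝓖₁.s a.1.1 = (leftAction 𝒳.toBispace 𝒴.toBispace).mom a.1.2 ∧
        𝓖₂.r a.2 = (diagAction 𝒳.toBispace 𝒴.toBispace).mom a.1.2} :=
    hR.continuousOn_tact.comp
      (f := fun a : (G₁ × FibreProd 𝒳.toBispace 𝒴.toBispace) × G₂ => (a.1.2, a.2))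
      (by fun_prop) fun a ha => ha.2.symm
  refine ContinuousOn.mul ?_ (hφ.comp_continuousOn h1)
  exact (continuousOn_compositeWeight hb).comp
    (f := fun a : (G₁ × FibreProd 𝒳.toBispace 𝒴.toBispace) × G₂ =>
      (a.1.1, (diagAction 𝒳.toBispace 𝒴.toBispace).tact a.1.2 a.2))
    ((by fun_prop : Continuous fun a : (G₁ × FibreProd 𝒳.toBispace 𝒴.toBispace) × G₂ =>
      a.1.1).continuousOn.prodMk h1)
    fun a ha => ha.1.trans (leftAction_mom_diagAction_tact _ _).symm

theorem continuousOn_compositeWeight_orbit_left (hb : IsCompositeCochain 𝒳 𝒴 b)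
    (hφ : Continuous φ) {g : G₁} {z : FibreProd 𝒳.toBispace 𝒴.toBispace}
    (h : 𝓖₁.s g = (leftAction 𝒳.toBispace 𝒴.toBispace).mom z) :
    ContinuousOn (fun γ : G₂ =>
        compositeWeight b g ((diagAction 𝒳.toBispace 𝒴.toBispace).tact z γ) *
          φ ((diagAction 𝒳.toBispace 𝒴.toBispace).tact z γ))
      (𝓖₂.r ⁻¹' {(diagAction 𝒳.toBispace 𝒴.toBispace).mom z}) :=
  (continuousOn_compositeWeight_orbit hb hφ).comp (f := fun γ : G₂ => ((g, z), γ))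
    (by fun_prop) fun _ hγ => ⟨h, hγ⟩

variable [T2Space G₂] [LocallyCompactSpace G₂]
  [LocallyCompactSpace (FibreProd 𝒳.toBispace 𝒴.toBispace)]

/-- The weight itself is not shown to be constant on orbits; its average against φ is an orbit
integral and hence independent of the representative. -/
theorem compositeAdj_proj (hb : IsCompositeCochain 𝒳 𝒴 b)
    (hφ : IsCutoff 𝓖₂ (diagAction 𝒳.toBispace 𝒴.toBispace) proj φ)
    (hP : (diagAction 𝒳.toBispace 𝒴.toBispace).IsProper)
    (hπ : (diagAction 𝒳.toBispace 𝒴.toBispace).IsOrbitMap proj) {g : G₁}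
    {z : FibreProd 𝒳.toBispace 𝒴.toBispace}
    (h : 𝓖₁.s g = (leftAction 𝒳.toBispace 𝒴.toBispace).mom z) :
    compositeAdj b φ g (proj z) = orbInt 𝓖₂ (diagAction 𝒳.toBispace 𝒴.toBispace)
      (fun z => compositeWeight b g z * φ z) z := by
  obtain ⟨K, hK, hK'⟩ := hπ.exists_isCompact hP hφ.hasFibrewiseCompactSupport z
  refine (orbInt_eq_of_proj_eq hπ (continuousOn_compositeWeight_orbit_left hb hφ.continuous h) hK
    (fun γ hγ h0 => hK' γ hγ (right_ne_zero_of_mul h0)) (proj_rep _).symm).symm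

variable [BorelSpace G₂]

theorem continuousOn_compositeAdj [T2Space U₂] (hb : IsCompositeCochain 𝒳 𝒴 b)
    (hφ : IsCutoff 𝓖₂ (diagAction 𝒳.toBispace 𝒴.toBispace) proj φ)
    (hP : (diagAction 𝒳.toBispace 𝒴.toBispace).IsProper)
    (hπ : (diagAction 𝒳.toBispace 𝒴.toBispace).IsOrbitMap proj) :
    ContinuousOn (fun a : G₁ × OrbitSpace 𝒳.toBispace 𝒴.toBispace => compositeAdj b φ a.1 a.2)
      {a | 𝓖₁.s a.1 = leftMom a.2} := by
  refine (IsOpenQuotientMap.prodMap .id hπ.isOpenQuotientMap).continuousOn_of_comp ?_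
  let S : Set (G₁ × FibreProd 𝒳.toBispace 𝒴.toBispace) :=
    {a | 𝓖₁.s a.1 = (leftAction 𝒳.toBispace 𝒴.toBispace).mom a.2}
  have hR := diagAction_isContinuous 𝒳.right_continuous 𝒴.left_continuous
  suffices h : ContinuousOn (fun a : G₁ × FibreProd 𝒳.toBispace 𝒴.toBispace =>
      orbInt 𝓖₂ (diagAction 𝒳.toBispace 𝒴.toBispace)
        (fun z => compositeWeight b a.1 z * φ z) a.2) S from
    h.congr fun a ha => compositeAdj_proj hb hφ hP hπ ha
  rw [continuousOn_iff_continuous_domRestrict]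
  have hζ : Continuous fun t : S => t.1.2 := by fun_prop
  refine 𝓖₂.haar_family.continuous_fibre_integral 𝓖₂.continuous_r (hR.mom.comp hζ)
    (F := fun (t : S) γ => compositeWeight b t.1.1
      ((diagAction 𝒳.toBispace 𝒴.toBispace).tact t.1.2 γ) *
        φ ((diagAction 𝒳.toBispace 𝒴.toBispace).tact t.1.2 γ)) ?_ fun t₀ => ?_
  · exact (continuousOn_compositeWeight_orbit hb hφ.continuous).comp
      (f := fun a : S × G₂ => (a.1.1, a.2)) (by fun_prop) fun a ha => ⟨a.1.2, ha⟩
  · obtain ⟨N, hN, K, hK, hK'⟩ :=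
      hπ.exists_nhds_isCompact hP hφ.hasFibrewiseCompactSupport hζ t₀
    exact ⟨N, hN, K, hK, fun t ht γ hγ h0 => hK' t ht γ hγ (right_ne_zero_of_mul h0)⟩

/-- The weight is positive along the orbit, so a vanishing average would force φ = 0 almost
everywhere on it, against its orbit integral being 1. -/
theorem compositeAdj_pos [T2Space U₂] (hb : IsCompositeCochain 𝒳 𝒴 b)
    (hφ : IsCutoff 𝓖₂ (diagAction 𝒳.toBispace 𝒴.toBispace) proj φ)
    (hP : (diagAction 𝒳.toBispace 𝒴.toBispace).IsProper)
    (hπ : (diagAction 𝒳.toBispace 𝒴.toBispace).IsOrbitMap proj) {g : G₁}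
    {z : FibreProd 𝒳.toBispace 𝒴.toBispace}
    (h : 𝓖₁.s g = (leftAction 𝒳.toBispace 𝒴.toBispace).mom z) :
    0 < compositeAdj b φ g (proj z) := by
  rw [compositeAdj_proj hb hφ hP hπ h]
  obtain ⟨K, hK, hK'⟩ := hπ.exists_isCompact hP hφ.hasFibrewiseCompactSupport z
  have hw : ∀ γ, 𝓖₂.r γ = (diagAction 𝒳.toBispace 𝒴.toBispace).mom z →
      0 < compositeWeight b g ((diagAction 𝒳.toBispace 𝒴.toBispace).tact z γ) := fun γ _ =>
    compositeWeight_pos hb (h.trans (leftAction_mom_diagAction_tact z γ).symm)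
  have hnn : 0 ≤ᵐ[𝓖₂.haar ((diagAction 𝒳.toBispace 𝒴.toBispace).mom z)] fun γ =>
      compositeWeight b g ((diagAction 𝒳.toBispace 𝒴.toBispace).tact z γ) *
        φ ((diagAction 𝒳.toBispace 𝒴.toBispace).tact z γ) := by
    filter_upwards [𝓖₂.haar_family.ae_eq _] with γ hγ
    exact mul_nonneg (hw γ hγ).le (hφ.nonneg _)
  refine lt_of_le_of_ne (integral_nonneg_of_ae hnn) fun h0 => ?_
  have hinteg := 𝓖₂.haar_family.integrable 𝓖₂.continuous_r _
    (continuousOn_compositeWeight_orbit_left hb hφ.continuous h) hK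
    (fun γ hγ h0 => hK' γ hγ (right_ne_zero_of_mul h0))
  have hae := (integral_eq_zero_iff_of_nonneg_ae hnn hinteg).1 h0.symm
  refine one_ne_zero ((hφ.orbInt_eq_one z).symm.trans (integral_eq_zero_of_ae ?_))
  filter_upwards [hae, 𝓖₂.haar_family.ae_eq _] with γ hγ hγ'
  exact (mul_eq_zero.1 hγ).resolve_left (hw γ hγ').ne'

end CompositeAdjoining

theorem exists_compactlySupported_extension {X : Type*} [TopologicalSpace X] [T2Space X]
    [LocallyCompactSpace X] {P : X → Prop} (hS : IsClosed {x | P x}) (F : C_c({x // P x}, ℝ)) :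
    ∃ F' : C_c(X, ℝ), ∀ x (h : P x), F' x = F ⟨x, h⟩ := by
  classical
  obtain ⟨F', hF'⟩ := exists_compactlySupported_eqOn hS
    (F.hasCompactSupport.isCompact.image continuous_subtype_val)
    (f := fun x => if h : P x then F ⟨x, h⟩ else 0) (by
      rw [continuousOn_iff_continuous_domRestrict]
      refine F.continuous.congr fun x => ?_
      have hx : P x.1 := x.2
      change F x = if h : P x.1 then F ⟨x.1, h⟩ else 0
      rw [dif_pos hx])
    (fun x (hx : P x) h0 => ⟨⟨x, hx⟩, subset_tsupport _ (by rwa [dif_pos hx] at h0), rfl⟩)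
  exact ⟨F', fun x h => (hF' x h).trans (dif_pos h)⟩

/-! ### The adjoining identity of the composite -/

section CompositeAdjoining

open FibreProd OrbitSpace

variable {G₁ U₁ G₂ U₂ G₃ U₃ X Y : Type*}
  [TopologicalSpace G₁] [TopologicalSpace U₁] [TopologicalSpace G₂] [TopologicalSpace U₂]
  [TopologicalSpace G₃] [TopologicalSpace U₃] [TopologicalSpace X] [TopologicalSpace Y]
  [MeasurableSpace G₁] [MeasurableSpace G₂] [MeasurableSpace G₃]
  [MeasurableSpace X] [MeasurableSpace Y]
  {𝓖₁ : HaarGroupoid G₁ U₁} {𝓖₂ : HaarGroupoid G₂ U₂} {𝓖₃ : HaarGroupoid G₃ U₃}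
  {𝒳 : TopologicalCorrespondence 𝓖₁ 𝓖₂ X} {𝒴 : TopologicalCorrespondence 𝓖₂ 𝓖₃ Y}
  {b φ : FibreProd 𝒳.toBispace 𝒴.toBispace → ℝ}
  {μ : U₃ → Measure (OrbitSpace 𝒳.toBispace 𝒴.toBispace)}

/-- The integrand that lifts the right-hand side of the adjoining identity to the fibre
product. -/
def adjoiningIntegrand (b φ : FibreProd 𝒳.toBispace 𝒴.toBispace → ℝ)
    (F : G₁ × OrbitSpace 𝒳.toBispace 𝒴.toBispace → ℝ) (g : G₁)
    (w : FibreProd 𝒳.toBispace 𝒴.toBispace) : ℝ :=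
  F (g, proj w) * (compositeWeight b g w * φ w)

theorem mul_ne_zero_of_adjoiningIntegrand_ne_zero
    {F : G₁ × OrbitSpace 𝒳.toBispace 𝒴.toBispace → ℝ} {g : G₁}
    {w : FibreProd 𝒳.toBispace 𝒴.toBispace} (h : adjoiningIntegrand b φ F g w ≠ 0) :
    F (g, proj w) * φ w ≠ 0 :=
  mul_ne_zero (left_ne_zero_of_mul h) (right_ne_zero_of_mul (right_ne_zero_of_mul h))

theorem continuousOn_adjoiningIntegrand (hb : IsCompositeCochain 𝒳 𝒴 b) (hφ : Continuous φ)
    {F : G₁ × OrbitSpace 𝒳.toBispace 𝒴.toBispace → ℝ} (hF : Continuous F) :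
    ContinuousOn (fun a : G₁ × FibreProd 𝒳.toBispace 𝒴.toBispace =>
        adjoiningIntegrand b φ F a.1 a.2)
      {a | 𝓖₁.s a.1 = (leftAction 𝒳.toBispace 𝒴.toBispace).mom a.2} := by
  refine ContinuousOn.mul (Continuous.continuousOn ?_)
    ((continuousOn_compositeWeight hb).mul (hφ.comp continuous_snd).continuousOn)
  exact hF.comp (continuous_fst.prodMk (isQuotientMap_proj.continuous.comp continuous_snd))

theorem IsCutoff.exists_isCompact_mul
    (hφ : IsCutoff 𝓖₂ (diagAction 𝒳.toBispace 𝒴.toBispace) proj φ)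
    (F : C_c(G₁ × OrbitSpace 𝒳.toBispace 𝒴.toBispace, ℝ)) :
    ∃ (K : Set G₁) (C : Set (FibreProd 𝒳.toBispace 𝒴.toBispace)), IsCompact K ∧ IsCompact C ∧
      ∀ g w, F (g, proj w) * φ w ≠ 0 → g ∈ K ∧ w ∈ C := by
  obtain ⟨C, hC, hC'⟩ := hφ.hasFibrewiseCompactSupport _
    (F.hasCompactSupport.isCompact.image continuous_snd)
  refine ⟨_, C, F.hasCompactSupport.isCompact.image continuous_fst, hC, fun g w h => ?_⟩
  have h1 := subset_tsupport _ (left_ne_zero_of_mul h)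
  exact ⟨⟨_, h1, rfl⟩, hC' w ⟨_, h1, rfl⟩ (right_ne_zero_of_mul h)⟩

variable [T2Space G₁] [LocallyCompactSpace G₁]

theorem exists_inv_integral [BorelSpace G₁] [T2Space U₁]
    [T2Space (OrbitSpace 𝒳.toBispace 𝒴.toBispace)]
    (F : C_c(G₁ × OrbitSpace 𝒳.toBispace 𝒴.toBispace, ℝ)) :
    ∃ f : C_c(OrbitSpace 𝒳.toBispace 𝒴.toBispace, ℝ),
      ∀ ω, f ω = ∫ g, F (𝓖₁.inv g, ω) ∂𝓖₁.haar ω.leftMom := by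
  have hK := (F.hasCompactSupport.isCompact.image continuous_fst).image 𝓖₁.continuous_inv
  have hC := F.hasCompactSupport.isCompact.image continuous_snd
  refine ⟨⟨⟨fun ω => ∫ g, F (𝓖₁.inv g, ω) ∂𝓖₁.haar ω.leftMom, ?_⟩, ?_⟩, fun _ => rfl⟩
  · refine 𝓖₁.haar_family.continuous_fibre_integral 𝓖₁.continuous_r
      (continuous_leftMom 𝒳.left_continuous) (F := fun ω g => F (𝓖₁.inv g, ω)) ?_
      fun ω => ⟨Set.univ, Filter.univ_mem, _, hK, fun ω _ g _ h0 => ?_⟩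
    · exact (F.continuous.comp
        ((𝓖₁.continuous_inv.comp continuous_snd).prodMk continuous_fst)).continuousOn
    · exact ⟨_, ⟨_, subset_tsupport _ h0, rfl⟩, 𝓖₁.inv_inv g⟩
  · refine HasCompactSupport.of_support_subset_isCompact hC fun ω hω => ?_
    by_contra hcon
    refine hω (𝓖₁.haar_family.integral_eq_zero fun g _ => ?_)
    by_contra h0
    exact hcon ⟨_, subset_tsupport _ h0, rfl⟩

section Fibrewise

variable [T2Space X] [LocallyCompactSpace X] [T2Space U₁] [T2Space U₂]

/-- The adjoining identity of the first correspondence, multiplied by the cochain and integrated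
over a fibre of `X ×_{U₂} Y → Y`. -/
theorem integral_adjoiningIntegrand (hb : IsCompositeCochain 𝒳 𝒴 b) (hφ : Continuous φ)
    {F : G₁ × OrbitSpace 𝒳.toBispace 𝒴.toBispace → ℝ} (hF : Continuous F) {K : Set G₁}
    {C : Set (FibreProd 𝒳.toBispace 𝒴.toBispace)} (hK : IsCompact K) (hC : IsCompact C)
    (hKC : ∀ g w, F (g, proj w) * φ w ≠ 0 → g ∈ K ∧ w ∈ C) (y : Y) :
    ∫ x, fibExt (fun z => φ z * (∫ g, F (𝓖₁.inv g, proj z) ∂𝓖₁.haar (𝒳.left.mom z.fst)) * b z)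
        x y ∂𝒳.lam (𝒴.left.mom y) =
      ∫ x, fibExt (fun z => (∫ g, adjoiningIntegrand b φ F g
          ((leftAction 𝒳.toBispace 𝒴.toBispace).tact (𝓖₁.inv g) z)
            ∂𝓖₁.haar (𝒳.left.mom z.fst)) * b z) x y ∂𝒳.lam (𝒴.left.mom y) := by
  have hclT : IsClosed {a : G₁ × X | 𝓖₁.s a.1 = 𝒳.left.mom a.2} :=
    isClosed_eq (𝓖₁.continuous_s.comp continuous_fst)
      (𝒳.left_continuous.mom.comp continuous_snd)
  have : LocallyCompactSpace 𝒳.left.Trans := hclT.isClosedEmbedding_subtypeVal.locallyCompactSpace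
  have hcl : IsClosed {p : 𝒳.left.Trans | 𝒳.right.mom p.1.2 = 𝒴.left.mom y} :=
    isClosed_eq (𝒳.right_continuous.mom.comp (continuous_snd.comp continuous_subtype_val))
      continuous_const
  -- With `y` fixed, this is the test function for the identity of Δ₁. It is meaningful only for x
  -- over the same unit as y, whence the extension `E` below.
  let f : 𝒳.left.Trans → ℝ := fun p => fibExt (fun z => F (p.1.1, proj z) * φ z * b z) p.1.2 y
  have hfc : ContinuousOn f {p | 𝒳.right.mom p.1.2 = 𝒴.left.mom y} := by
    rw [continuousOn_iff_continuous_domRestrict]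
    let ζ : {p : 𝒳.left.Trans | 𝒳.right.mom p.1.2 = 𝒴.left.mom y} →
        FibreProd 𝒳.toBispace 𝒴.toBispace := fun q => ⟨(q.1.1.2, y), q.2⟩
    have hζ : Continuous ζ := Continuous.subtype_mk (by fun_prop) _
    have h1 : Continuous fun q : {p : 𝒳.left.Trans | 𝒳.right.mom p.1.2 = 𝒴.left.mom y} =>
        F (q.1.1.1, proj (ζ q)) * φ (ζ q) * b (ζ q) := by
      refine ((hF.comp (Continuous.prodMk (by fun_prop)
        (isQuotientMap_proj.continuous.comp hζ))).mul (hφ.comp hζ)).mul (hb.continuous.comp hζ)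
    refine h1.congr fun q => ?_
    have hq : 𝒳.right.mom q.1.1.2 = 𝒴.left.mom y := q.2
    exact (fibExt_eq (fun z => F (q.1.1.1, proj z) * φ z * b z) hq).symm
  obtain ⟨E, hE⟩ := exists_compactlySupported_eqOn hcl (f := f) (K := Subtype.val ⁻¹'
      (K ×ˢ (fst '' C)))
    (hclT.isClosedEmbedding_subtypeVal.isCompact_preimage (hK.prod (hC.image continuous_fst')))
    hfc fun p hp h0 => by
      have h0' : F (p.1.1, proj ⟨(p.1.2, y), hp⟩) * φ ⟨(p.1.2, y), hp⟩ ≠ 0 := by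
        have : f p = F (p.1.1, proj ⟨(p.1.2, y), hp⟩) * φ ⟨(p.1.2, y), hp⟩ * b ⟨(p.1.2, y), hp⟩ :=
          fibExt_eq _ hp
        rw [this] at h0
        exact left_ne_zero_of_mul h0
      obtain ⟨h1, h2⟩ := hKC _ _ h0'
      exact ⟨h1, ⟨_, h2, rfl⟩⟩
  have key := 𝒳.adjoining.integral_eq (𝒴.left.mom y) E
  refine Eq.trans ?_ (key.trans ?_)
  · refine 𝒳.family.integral_congr fun x hx => ?_
    rw [fibExt_eq _ hx]
    change φ ⟨(x, y), hx⟩ * (∫ g, F (𝓖₁.inv g, proj ⟨(x, y), hx⟩) ∂𝓖₁.haar (𝒳.left.mom x)) *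
      b ⟨(x, y), hx⟩ = _
    rw [mul_right_comm, ← integral_const_mul]
    refine 𝓖₁.haar_family.integral_congr fun g hg => ?_
    rw [dif_pos hg, hE _ hx]
    refine Eq.trans ?_ (fibExt_eq _ hx).symm
    change _ = F (𝓖₁.inv g, proj ⟨(x, y), hx⟩) * _ * _
    ring
  · refine 𝒳.family.integral_congr fun x hx => ?_
    rw [fibExt_eq _ hx]
    change _ = (∫ g, adjoiningIntegrand b φ F g
      ((leftAction 𝒳.toBispace 𝒴.toBispace).tact (𝓖₁.inv g) ⟨(x, y), hx⟩)
        ∂𝓖₁.haar (𝒳.left.mom x)) * b ⟨(x, y), hx⟩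
    rw [← integral_mul_const]
    refine 𝓖₁.haar_family.integral_congr fun g hg => ?_
    have hg' : 𝓖₁.s (𝓖₁.inv g) = 𝒳.left.mom x := (𝓖₁.s_inv g).trans hg
    have hx' : 𝒳.right.mom (𝒳.left.act (𝓖₁.inv g) x hg') = 𝒴.left.mom y :=
      (𝒳.right_mom_act _ _ _).trans hx
    have ht : (leftAction 𝒳.toBispace 𝒴.toBispace).tact (𝓖₁.inv g) ⟨(x, y), hx⟩ =
        ⟨(𝒳.left.act (𝓖₁.inv g) x hg', y), hx'⟩ :=
      (leftAction 𝒳.toBispace 𝒴.toBispace).tact_eq (x := ⟨(x, y), hx⟩) hg'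
    have htt := (leftAction 𝒳.toBispace 𝒴.toBispace).tact_tact_inv (z := ⟨(x, y), hx⟩) hg
    rw [ht] at htt
    have hc : 𝓖₁.s g = 𝒳.left.mom (𝒳.left.act (𝓖₁.inv g) x hg') :=
      ((𝒳.left.mom_act _ _ _).trans (𝓖₁.r_inv g)).symm
    -- The denominator in the weight is b at g(g⁻¹z) = z, so multiplying by b(z) leaves b(g⁻¹z), as
    -- the identity for Δ₁ requires.
    have hrhs : adjoiningIntegrand b φ F g ⟨(𝒳.left.act (𝓖₁.inv g) x hg', y), hx'⟩ =
        F (g, proj ⟨(𝒳.left.act (𝓖₁.inv g) x hg', y), hx'⟩) *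
          (adjExt 𝒳 g (𝒳.left.act (𝓖₁.inv g) x hg') *
            (b ⟨(𝒳.left.act (𝓖₁.inv g) x hg', y), hx'⟩ / b ⟨(x, y), hx⟩) *
          φ ⟨(𝒳.left.act (𝓖₁.inv g) x hg', y), hx'⟩) := by
      rw [← htt]; rfl
    rw [dif_pos hg, hE _ hx', ht, hrhs]
    have hf : f (𝒳.left.movePt g x hg) =
        F (g, proj ⟨(𝒳.left.act (𝓖₁.inv g) x hg', y), hx'⟩) *
          φ ⟨(𝒳.left.act (𝓖₁.inv g) x hg', y), hx'⟩ *
          b ⟨(𝒳.left.act (𝓖₁.inv g) x hg', y), hx'⟩ := fibExt_eq _ hx'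
    have ha : adjExt 𝒳 g (𝒳.left.act (𝓖₁.inv g) x hg') = 𝒳.adj (𝒳.left.movePt g x hg) :=
      adjExt_eq hc
    rw [hf, ha]
    have hb0 := (hb.pos ⟨(x, y), hx⟩).ne'
    field_simp

end Fibrewise

variable [BorelSpace G₁] [T2Space G₂] [LocallyCompactSpace G₂] [BorelSpace G₂] [T2Space U₁]
  [T2Space U₂] [LocallyCompactSpace (FibreProd 𝒳.toBispace 𝒴.toBispace)]

/-- Unfolding the average gives a double integral over `G₁` and `G₂`. The two actions on Z commute,
π is constant on `G₂`-orbits, and Fubini exchanges the integrals. -/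
theorem integral_compositeAdj_eq (hb : IsCompositeCochain 𝒳 𝒴 b)
    (hφ : IsCutoff 𝓖₂ (diagAction 𝒳.toBispace 𝒴.toBispace) proj φ)
    (hP : (diagAction 𝒳.toBispace 𝒴.toBispace).IsProper)
    (hπ : (diagAction 𝒳.toBispace 𝒴.toBispace).IsOrbitMap proj)
    {F : G₁ × OrbitSpace 𝒳.toBispace 𝒴.toBispace → ℝ} (hF : Continuous F) {K : Set G₁}
    {C : Set (FibreProd 𝒳.toBispace 𝒴.toBispace)} (hK : IsCompact K) (hC : IsCompact C)
    (hKC : ∀ g w, F (g, proj w) * φ w ≠ 0 → g ∈ K ∧ w ∈ C)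
    (z : FibreProd 𝒳.toBispace 𝒴.toBispace) :
    ∫ g, F (g, leftActAux (𝓖₁.inv g) (proj z)) *
        compositeAdj b φ g (leftActAux (𝓖₁.inv g) (proj z)) ∂𝓖₁.haar (𝒳.left.mom z.fst) =
      orbInt 𝓖₂ (diagAction 𝒳.toBispace 𝒴.toBispace) (fun w =>
        ∫ g, adjoiningIntegrand b φ F g
          ((leftAction 𝒳.toBispace 𝒴.toBispace).tact (𝓖₁.inv g) w)
            ∂𝓖₁.haar ((leftAction 𝒳.toBispace 𝒴.toBispace).mom w)) z := by
  set L := leftAction 𝒳.toBispace 𝒴.toBispace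
  set R := diagAction 𝒳.toBispace 𝒴.toBispace
  have hL : L.IsContinuous := leftAction_isContinuous 𝒳.left_continuous
  have hR : R.IsContinuous := diagAction_isContinuous 𝒳.right_continuous 𝒴.left_continuous
  obtain ⟨M, hM, hM'⟩ := hL.exists_isCompact_translate hK hC
  -- The integrand vanishes unless zγ lies in `M`, so properness provides the compact set of γ
  -- needed for Fubini.
  obtain ⟨N, hN, hN'⟩ := hP.exists_isCompact (isCompact_singleton (x := z)) hM
  have hcomm : ∀ g γ, 𝓖₁.r g = L.mom z → 𝓖₂.r γ = R.mom z →
      L.tact (𝓖₁.inv g) (R.tact z γ) = R.tact (L.tact (𝓖₁.inv g) z) γ := fun g γ hg hγ =>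
    leftAction_tact_diagAction_tact ((𝓖₁.s_inv g).trans hg) hγ.symm
  have hswap : ∫ γ, ∫ g, adjoiningIntegrand b φ F g (L.tact (𝓖₁.inv g) (R.tact z γ))
        ∂𝓖₁.haar (L.mom z) ∂𝓖₂.haar (R.mom z) =
      ∫ g, ∫ γ, adjoiningIntegrand b φ F g (L.tact (𝓖₁.inv g) (R.tact z γ))
        ∂𝓖₂.haar (R.mom z) ∂𝓖₁.haar (L.mom z) := by
    refine 𝓖₂.haar_family.integral_swap 𝓖₂.continuous_r 𝓖₁.haar_family 𝓖₁.continuous_r ?_ hN hK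
      fun γ g hγ hg h0 => ?_
    · refine (hL.continuousOn_translate
        (continuousOn_adjoiningIntegrand hb hφ.continuous hF)).comp
        (f := fun a : G₂ × G₁ => (R.tact z a.1, a.2)) (ContinuousOn.prodMk ?_ (by fun_prop))
        fun a ha => ha.2.trans (leftAction_mom_diagAction_tact z a.1).symm
      exact (hR.continuousOn_tact_left z).comp continuous_fst.continuousOn fun a ha => ha.1
    · obtain ⟨h1, h2⟩ := hKC _ _ (mul_ne_zero_of_adjoiningIntegrand_ne_zero h0)
      refine ⟨hN' z γ hγ.symm rfl ?_, h1⟩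
      rw [← R.tact_eq]
      exact hM' g _ (hg.trans (leftAction_mom_diagAction_tact z γ).symm) h1 h2
  refine Eq.trans ?_ (hswap.symm.trans ?_)
  · refine 𝓖₁.haar_family.integral_congr fun g hg => ?_
    have hg' : 𝓖₁.r g = L.mom z := hg
    rw [← proj_leftAction_tact, compositeAdj_proj hb hφ hP hπ (L.mom_tact_inv hg'), orbInt,
      ← integral_const_mul, diagAction_mom_leftAction_tact]
    refine 𝓖₂.haar_family.integral_congr fun γ hγ => ?_
    rw [hcomm g γ hg' hγ, adjoiningIntegrand, proj_diagAction_tact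
      ((diagAction_mom_leftAction_tact _ _).trans hγ.symm)]
  · refine 𝓖₂.haar_family.integral_congr fun γ hγ => ?_
    simp only [leftAction_mom_diagAction_tact, L, R]

/-- The left side is the μ_u-integral of the function `f` obtained by integrating out `G₁`. It is
moved to Z by the cutoff formula, transformed there by the identity for Δ₁ into the integral of `H
b`, and returned to Ω by the lifting property for `H`, whose orbit integral is the inner integral of
the right side. -/
theorem IsComposite.isAdjoining [T2Space X] [T2Space Y] [LocallyCompactSpace X]
    [T2Space (OrbitSpace 𝒳.toBispace 𝒴.toBispace)]
    [LocallyCompactSpace (OrbitSpace 𝒳.toBispace 𝒴.toBispace)] (hμ : IsComposite 𝒳 𝒴 b μ)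
    (hφ : IsCutoff 𝓖₂ (diagAction 𝒳.toBispace 𝒴.toBispace) proj φ)
    (hP : (diagAction 𝒳.toBispace 𝒴.toBispace).IsProper)
    (hπ : (diagAction 𝒳.toBispace 𝒴.toBispace).IsOrbitMap proj) :
    IsAdjoining 𝓖₁ (bispace 𝒳.toBispace 𝒴.toBispace).left μ
      fun p => compositeAdj b φ p.1.1 p.1.2 where
  continuous := (continuousOn_compositeAdj hμ.cochain hφ hP hπ).domRestrict
  pos := by
    rintro ⟨⟨g, ω⟩, h⟩
    obtain ⟨z, rfl⟩ := proj_surjective ω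
    exact compositeAdj_pos hμ.cochain hφ hP hπ h
  integral_eq u F₀ := by
    have hcl : IsClosed {a : G₁ × OrbitSpace 𝒳.toBispace 𝒴.toBispace |
        𝓖₁.s a.1 = (bispace 𝒳.toBispace 𝒴.toBispace).left.mom a.2} :=
      isClosed_eq (𝓖₁.continuous_s.comp continuous_fst)
        ((continuous_leftMom 𝒳.left_continuous).comp continuous_snd)
    obtain ⟨F, hF⟩ := exists_compactlySupported_extension hcl F₀
    obtain ⟨f, hf⟩ := exists_inv_integral F
    obtain ⟨K, C, hK, hC, hKC⟩ := hφ.exists_isCompact_mul F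
    obtain ⟨H, hH⟩ := (leftAction_isContinuous (B := 𝒴.toBispace)
      𝒳.left_continuous).exists_translate_integral
      (continuousOn_adjoiningIntegrand hμ.cochain hφ.continuous F.continuous) hK hC
      fun g w _ h0 => hKC g w (mul_ne_zero_of_adjoiningIntegrand_ne_zero h0)
    calc _ = ∫ ω, f ω ∂μ u := by
          refine integral_congr_ae (.of_forall fun ω => ?_)
          refine Eq.trans ?_ (hf ω).symm
          refine 𝓖₁.haar_family.integral_congr fun g hg => ?_
          rw [dif_pos hg]
          exact (hF (𝓖₁.inv g, ω) ((𝓖₁.s_inv g).trans hg)).symm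
      _ = fibreProdIntegral 𝒳 𝒴 u fun z => H z * b z := by
          rw [hμ.integral_eq hφ hπ, fibreProdIntegral_eq, fibreProdIntegral_eq]
          congr 1
          funext y
          simp only [hf, hH]
          exact integral_adjoiningIntegrand hμ.cochain hφ.continuous F.continuous hK hC hKC y
      _ = ∫ ω, orbitIntegral 𝒳 𝒴 H ω ∂μ u := (hμ.lift u H).symm
      _ = _ := by
          refine integral_congr_ae (.of_forall fun ω => ?_)
          rw [orbitIntegral_eq, funext hH, ← integral_compositeAdj_eq hμ.cochain hφ hP hπ
            F.continuous hK hC hKC]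
          have hm : 𝒳.left.mom ω.rep.fst = (bispace 𝒳.toBispace 𝒴.toBispace).left.mom ω :=
            congrArg leftMom (proj_rep ω)
          rw [hm, proj_rep]
          refine 𝓖₁.haar_family.integral_congr fun g hg => ?_
          rw [dif_pos hg]
          exact congrArg (· * compositeAdj b φ g (leftActAux (𝓖₁.inv g) ω)) (hF _ _)

end CompositeAdjoining

/-! ### The composite as a topological correspondence -/

section Composite

open FibreProd OrbitSpace

variable {G₁ U₁ G₂ U₂ G₃ U₃ X Y : Type*}
  [TopologicalSpace G₁] [TopologicalSpace U₁] [TopologicalSpace G₂] [TopologicalSpace U₂]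
  [TopologicalSpace G₃] [TopologicalSpace U₃] [TopologicalSpace X] [TopologicalSpace Y]
  [MeasurableSpace G₁] [MeasurableSpace G₂] [MeasurableSpace G₃]
  [MeasurableSpace X] [MeasurableSpace Y]
  [T2Space G₁] [LocallyCompactSpace G₁] [BorelSpace G₁] [T2Space G₂] [LocallyCompactSpace G₂]
  [BorelSpace G₂] [BorelSpace X]
  {𝓖₁ : HaarGroupoid G₁ U₁} {𝓖₂ : HaarGroupoid G₂ U₂} {𝓖₃ : HaarGroupoid G₃ U₃}
  {𝒳 : TopologicalCorrespondence 𝓖₁ 𝓖₂ X} {𝒴 : TopologicalCorrespondence 𝓖₂ 𝓖₃ Y}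

/-- A composite of two topological correspondences is a topological correspondence. -/
def IsComposite.toTopologicalCorrespondence [T2Space X] [T2Space Y] [LocallyCompactSpace X]
    [LocallyCompactSpace Y] [T2Space U₁] [T2Space U₂] [T2Space U₃]
    [LocallyCompactSpace (FibreProd 𝒳.toBispace 𝒴.toBispace)]
    [T2Space (OrbitSpace 𝒳.toBispace 𝒴.toBispace)]
    [LocallyCompactSpace (OrbitSpace 𝒳.toBispace 𝒴.toBispace)]
    {b φ : FibreProd 𝒳.toBispace 𝒴.toBispace → ℝ}
    {μ : U₃ → Measure (OrbitSpace 𝒳.toBispace 𝒴.toBispace)} (hμ : IsComposite 𝒳 𝒴 b μ)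
    (hφ : IsCutoff 𝓖₂ (diagAction 𝒳.toBispace 𝒴.toBispace) proj φ) :
    TopologicalCorrespondence 𝓖₁ 𝓖₃ (OrbitSpace 𝒳.toBispace 𝒴.toBispace) :=
  have hπ := isOrbitMap_proj 𝓖₂.isOpenMap_r 𝒳.right_continuous 𝒴.left_continuous
  { toBispace := bispace 𝒳.toBispace 𝒴.toBispace
    t2 := inferInstance
    locallyCompact := inferInstance
    left_continuous := bispace_left_isContinuous hπ.isOpenQuotientMap 𝒳.left_continuous
    right_continuous := bispace_right_isContinuous hπ.isOpenQuotientMap 𝒴.right_continuous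
    right_proper := bispace_right_isProper 𝓖₂.isOpenMap_r 𝒳.right_continuous 𝒴.left_continuous
      𝒴.right_continuous 𝒳.right_proper 𝒴.right_proper
    lam := μ
    family := hμ.isContinuousFamily hφ hπ
    invariant := hμ.isInvariantFamily hφ hπ
    adj := fun p => compositeAdj b φ p.1.1 p.1.2
    adjoining := hμ.isAdjoining hφ (diagAction_isProper 𝒳.right_continuous 𝒴.left_continuous
      𝒳.right_proper) hπ }

end Composite

end

/-! ### Comparison of two composites -/

theorem mainTheorem3
    {G₁ U₁ G₂ U₂ G₃ U₃ X Y : Type*}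
    [TopologicalSpace G₁] [T2Space G₁] [LocallyCompactSpace G₁]
    [MeasurableSpace G₁] [BorelSpace G₁]
    [TopologicalSpace G₂] [T2Space G₂] [LocallyCompactSpace G₂]
    [MeasurableSpace G₂] [BorelSpace G₂]
    [TopologicalSpace G₃] [T2Space G₃] [LocallyCompactSpace G₃]
    [MeasurableSpace G₃] [BorelSpace G₃]
    [TopologicalSpace U₁] [TopologicalSpace U₂] [TopologicalSpace U₃]
    [TopologicalSpace X] [MeasurableSpace X] [BorelSpace X]
    [TopologicalSpace Y] [MeasurableSpace Y] [BorelSpace Y]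
    (𝓖₁ : HaarGroupoid G₁ U₁) (𝓖₂ : HaarGroupoid G₂ U₂) (𝓖₃ : HaarGroupoid G₃ U₃)
    (𝒳 : TopologicalCorrespondence 𝓖₁ 𝓖₂ X) (𝒴 : TopologicalCorrespondence 𝓖₂ 𝓖₃ Y)
    [ParacompactSpace (OrbitSpace 𝒳.toBispace 𝒴.toBispace)]
    (b b' : FibreProd 𝒳.toBispace 𝒴.toBispace → ℝ)
    (μ μ' : U₃ → Measure (OrbitSpace 𝒳.toBispace 𝒴.toBispace))
    (hμ : IsComposite 𝒳 𝒴 b μ) (hμ' : IsComposite 𝒳 𝒴 b' μ') :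
    (∃ M M' : TopologicalCorrespondence 𝓖₁ 𝓖₃ (OrbitSpace 𝒳.toBispace 𝒴.toBispace),
      M.toBispace = OrbitSpace.bispace 𝒳.toBispace 𝒴.toBispace ∧ M.lam = μ ∧
      M'.toBispace = OrbitSpace.bispace 𝒳.toBispace 𝒴.toBispace ∧ M'.lam = μ' ∧
      IsCorrIso M M' (Homeomorph.refl (OrbitSpace 𝒳.toBispace 𝒴.toBispace))) ∧
    (∃! c : OrbitSpace 𝒳.toBispace 𝒴.toBispace → ℝ, ∀ z, b' z = c (OrbitSpace.proj z) * b z) ∧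
    (∀ c : OrbitSpace 𝒳.toBispace 𝒴.toBispace → ℝ,
      (∀ z, b' z = c (OrbitSpace.proj z) * b z) →
        Continuous c ∧ (∀ ω, 0 < c ω) ∧ IsRNDeriv μ' μ c) := by
  have := 𝒳.t2
  have := 𝒴.t2
  have := 𝒳.locallyCompact
  have := 𝒴.locallyCompact
  have := 𝓖₁.t2Space_units
  have := 𝓖₂.t2Space_units
  have := 𝓖₃.t2Space_units
  have := FibreProd.locallyCompactSpace 𝒳.right_continuous 𝒴.left_continuous
  have hR := FibreProd.diagAction_isContinuous 𝒳.right_continuous 𝒴.left_continuous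
  have hP := FibreProd.diagAction_isProper 𝒳.right_continuous 𝒴.left_continuous 𝒳.right_proper
  have hπ := OrbitSpace.isOrbitMap_proj 𝓖₂.isOpenMap_r 𝒳.right_continuous 𝒴.left_continuous
  have := hπ.t2Space hP
  have := hπ.isOpenQuotientMap.locallyCompactSpace
  obtain ⟨φ, hφ⟩ := exists_isCutoff (𝓗 := 𝓖₂) hR hP hπ
  -- The quotient is evaluated at a representative, whose choice is immaterial as the coboundaries
  -- agree. Stating it for arbitrary cochains allows both b'/b and b/b'.
  have hquot : ∀ {a a'}, IsCompositeCochain 𝒳 𝒴 a → IsCompositeCochain 𝒳 𝒴 a' →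
      ∃ c : OrbitSpace 𝒳.toBispace 𝒴.toBispace → ℝ,
        ∀ z, a' z = c (OrbitSpace.proj z) * a z := fun {a a'} ha ha' => by
    refine ⟨fun ω => a' ω.rep / a ω.rep, fun z => ?_⟩
    beta_reduce
    rw [ha.div_eq_of_proj_eq ha' (OrbitSpace.proj_rep (OrbitSpace.proj z)),
      div_mul_cancel₀ _ (ha.pos z).ne']
  refine ⟨⟨hμ.toTopologicalCorrespondence hφ, hμ'.toTopologicalCorrespondence hφ, rfl, rfl, rfl,
    rfl, ?_⟩, ?_, fun c hc => hμ.isRNDeriv hμ' hφ hπ hc⟩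
  -- Here `c` comes from b/b' and serves as the density of μ relative to μ'; the reverse quotient
  -- `c'` gives the other absolute continuity.
  · obtain ⟨c, hc⟩ := hquot hμ'.cochain hμ.cochain
    obtain ⟨c', hc'⟩ := hquot hμ.cochain hμ'.cochain
    obtain ⟨h1, h2, h3⟩ := hμ'.isRNDeriv hμ hφ hπ hc
    obtain ⟨-, -, h3'⟩ := hμ.isRNDeriv hμ' hφ hπ hc'
    refine ⟨fun _ => rfl, fun _ => rfl, fun _ _ _ => rfl, fun _ _ _ => rfl, ?_⟩
    have hid : (fun v => ((hμ.toTopologicalCorrespondence hφ).lam v).map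
        (Homeomorph.refl (OrbitSpace 𝒳.toBispace 𝒴.toBispace))) = μ :=
      funext fun v => Measure.map_id
    rw [hid]
    refine ⟨fun v => ⟨?_, ?_⟩, c, h1, h2, h3⟩
    · rw [h3 v]
      exact withDensity_absolutelyContinuous _ _
    · change μ' v ≪ μ v
      rw [h3' v]
      exact withDensity_absolutelyContinuous _ _
  · obtain ⟨c, hc⟩ := hquot hμ.cochain hμ'.cochain
    refine ⟨c, hc, fun d hd => funext fun ω => ?_⟩
    obtain ⟨z, rfl⟩ := OrbitSpace.proj_surjective ω
    exact mul_right_cancel₀ (hμ.cochain.pos z).ne' ((hd z).symm.trans (hc z))
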